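/- Let $F$ be a field, $V$ a finite-dimensional $F$-vector space, $\mathcal{K}$ a commutative ring, and $\mathcal{A}$ an affine hyperplane arrangement in $V$, i.e. a finite set of affine hyperplanes of $V$. Let $L(\mathcal{A})$ be the set of all nonempty intersections of hyperplanes of $\mathcal{A}$ (including the empty intersection $\hat 0=V$), ordered by reverse inclusion, with rank function $r(X)=\operatorname{codim} X$. An ideal of $L(\mathcal{A})$ is a nonempty down-closed subset; write $\langle X\rangle=\{Y\in L(\mathcal{A}) : Y\le X\}$. Ideals $\mathcal{I}_1,\dots,\mathcal{I}_m$ form an ideal decomposition of $L(\mathcal{A})$ if (I1) for every $X\in L(\mathcal{A})\setminus\{\hat 0\}$ there is a $j$ such that $\mathcal{I}_j\cap\langle X\rangle=\langle Z\rangle$ for some $Z\ne\hat 0$; (I2) for all $X_i\in\mathcal{I}_i$ ($1\le i\le m$) the intersection $X_1\cap\dots\cap X_m$ is nonempty; and (I3) in (I2), $r(X_1\cap\dots\cap X_m)=\sum_{i} r(X_i)$. An ideal $\mathcal{I}$ is modular if $\{\mathcal{I},\mathcal{I}^c\}$ is an ideal decomposition, where $\mathcal{I}^c=\{Y\in L(\mathcal{A})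 : Y\wedge X=\hat 0 \text{ for all } X\in\mathcal{I}\}$. Let $E(\mathcal{A})$ be the exterior algebra over $\mathcal{K}$ of the free $\mathcal{K}$-module with basis $\{e_H : H\in\mathcal{A}\}$, and let $\partial$ be the $\mathcal{K}$-linear map on $E(\mathcal{A})$ with $\partial(e_{H_1}\cdots e_{H_p})=\sum_{k=1}^p(-1)^{k-1}e_{H_1}\cdots\widehat{e_{H_k}}\cdots e_{H_p}$ (so $\partial 1=0$ and $\partial e_H=1$). For a tuple $S=(H_1,\dots,H_p)$ of hyperplanes of $\mathcal{A}$ put $e_S=e_{H_1}\cdots e_{H_p}$ and $\cap S=H_1\cap\dots\cap H_p$; $S$ is dependent if $\cap S\ne\emptyset$ and $r(\cap S)<p$. The Orlik–Solomon algebra is $A(\mathcal{A})=E(\mathcal{A})/I(\mathcal{A})$, where $I(\mathcal{A})$ is the two-sided ideal generated by all $e_S$ with $\cap S=\emptyset$ and all $\partial e_S$ with $S$ dependent; its degree $p$ part is the image of the $p$-th exterior power. For $X\in L(\mathcal{A})$ let $A_X(\mathcal{A})\subseteq A(\mathcal{A})$ be the $\mathcal{K}$-submodule spanned by the images of all $e_S$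 with $\cap S=X$. Then for every modular ideal $\mathcal{I}$ of $L(\mathcal{A})$, the $\mathcal{K}$-linear map $$\kappa\colon \Big(\bigoplus_{X\in\mathcal{I}}A_X(\mathcal{A})\Big)\otimes_{\mathcal{K}}\Big(\bigoplus_{Y\in\mathcal{I}^c}A_Y(\mathcal{A})\Big)\longrightarrow A(\mathcal{A})$$ defined by multiplication in $A(\mathcal{A})$ is an isomorphism of graded $\mathcal{K}$-modules, where the direct sums carry the grading induced from $A(\mathcal{A})$ and the tensor product the total grading: both sides are the direct sums of their degree $p$ parts ($p\ge 0$), $\kappa$ is bijective, and $\kappa$ maps the degree $p$ part onto the degree $p$ part for every $p$. -/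

import Mathlib

open scoped DirectSum TensorProduct

/-- The codimension of (the direction of) an affine subspace. -/
noncomputable def affineCodim {F V : Type*} [Field F] [AddCommGroup V] [Module F V]
    (X : AffineSubspace F V) : ℕ :=
  Module.finrank F (V ⧸ X.direction)

/-- A finite collection of affine hyperplanes in `V`. -/
structure HyperplaneArrangement (F V : Type*) [Field F] [AddCommGroup V] [Module F V] where
  hyperplanes : Finset (AffineSubspace F V)
  nonempty_of_mem : ∀ H ∈ hyperplanes, (H : Set V).Nonempty
  codim_eq_one : ∀ H ∈ hyperplanes, affineCodim H = 1

namespace HyperplaneArrangement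

section Poset

variable {F V : Type*} [Field F] [AddCommGroup V] [Module F V]

/-- The set of nonempty intersections of hyperplanes of `𝒜`
(the empty intersection being `V`). -/
def IntersectionPoset (𝒜 : HyperplaneArrangement F V) : Type _ :=
  {X : AffineSubspace F V // (X : Set V).Nonempty ∧ ∃ B ⊆ 𝒜.hyperplanes, B.inf id = X}

variable {𝒜 : HyperplaneArrangement F V}

/-- The order is reverse inclusion. -/
instance : PartialOrder 𝒜.IntersectionPoset where
  le X Y := Y.1 ≤ X.1
  le_refl X := le_refl X.1
  le_trans _ _ _ h h' := le_trans h' h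
  le_antisymm _ _ h h' := Subtype.ext (le_antisymm h' h)

/-- The minimal element is the whole space `V`. -/
instance : OrderBot 𝒜.IntersectionPoset where
  bot := ⟨⊤, ⟨0, trivial⟩, ∅, Finset.empty_subset _, Finset.inf_empty⟩
  bot_le X := (le_top : X.1 ≤ ⊤)

/-- The rank of an element of the intersection poset is its codimension. -/
noncomputable def rank (X : 𝒜.IntersectionPoset) : ℕ := affineCodim X.1

/-- Order ideals: nonempty down-closed subsets. -/
def IsOrderIdeal (I : Set 𝒜.IntersectionPoset) : Prop := I.Nonempty ∧ IsLowerSet I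

/-- `J` is a principal ideal `⟨Z⟩` with `Z` not the minimal element. -/
def IsNontrivialPrincipal (J : Set 𝒜.IntersectionPoset) : Prop :=
  ∃ Z : 𝒜.IntersectionPoset, Z ≠ ⊥ ∧ J = Set.Iic Z

/-- Ideal decompositions of the intersection poset. The join of a family of elements is
its intersection, and exists if and only if this intersection is nonempty. -/
structure IsIdealDecomposition {m : ℕ} (I : Fin m → Set 𝒜.IntersectionPoset) : Prop where
  ideal : ∀ j, IsOrderIdeal (I j)
  meet : ∀ X : 𝒜.IntersectionPoset, X ≠ ⊥ → ∃ j, IsNontrivialPrincipal (I j ∩ Set.Iic X)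
  join : ∀ X : Fin m → 𝒜.IntersectionPoset, (∀ j, X j ∈ I j) →
    ((⨅ j, (X j).1 : AffineSubspace F V) : Set V).Nonempty
  rank_join : ∀ X : Fin m → 𝒜.IntersectionPoset, (∀ j, X j ∈ I j) →
    affineCodim (⨅ j, (X j).1) = ∑ j, rank (X j)

/-- The meet-complement: all `Y` whose meet with every `X ∈ I` is the minimal element. -/
def meetComplement (I : Set 𝒜.IntersectionPoset) : Set 𝒜.IntersectionPoset :=
  {Y | ∀ X ∈ I, IsGLB {Y, X} ⊥}

/-- `I` is a modular ideal if `{I, Iᶜ}` is an ideal decomposition. -/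
def IsModularIdeal (I : Set 𝒜.IntersectionPoset) : Prop :=
  IsIdealDecomposition ![I, meetComplement I]

end Poset

section OrlikSolomon

variable {F V : Type*} [Field F] [AddCommGroup V] [Module F V]
variable (𝒜 : HyperplaneArrangement F V) (K : Type*) [CommRing K]

/-- The exterior algebra of the free module on the hyperplanes. -/
abbrev Ext : Type _ := ExteriorAlgebra K (𝒜.hyperplanes →₀ K)

variable {𝒜}

/-- `e_S = e_{H_1} ⋯ e_{H_p}` for a tuple `S = (H_1, …, H_p)` of hyperplanes. -/
noncomputable def e (S : List 𝒜.hyperplanes) : 𝒜.Ext K :=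
  (S.map fun H => ExteriorAlgebra.ι K (Finsupp.single H (1 : K))).prod

/-- `∩ S` for a tuple `S` of hyperplanes. -/
def inter (S : List 𝒜.hyperplanes) : AffineSubspace F V :=
  (S.map Subtype.val).foldr (· ⊓ ·) ⊤

/-- A tuple is dependent if it has nonempty intersection of codimension less than its length. -/
def Dependent (S : List 𝒜.hyperplanes) : Prop :=
  (inter S : Set V).Nonempty ∧ affineCodim (inter S) < S.length

variable (𝒜)

/-- The boundary map of the exterior algebra: contraction with the linear form
taking the value `1` on every `e_H`. See `boundary_e` for the explicit formula. -/
noncomputable def boundary : 𝒜.Ext K →ₗ[K] 𝒜.Ext K :=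
  CliffordAlgebra.contractLeft (Finsupp.linearCombination K fun _ : 𝒜.hyperplanes => (1 : K))

/-- `∂(e_{H_1} ⋯ e_{H_p}) = ∑ₖ (-1)^(k-1) e_{H_1} ⋯ ê_{H_k} ⋯ e_{H_p}`. -/
theorem boundary_e (S : List 𝒜.hyperplanes) :
    boundary 𝒜 K (e K S) =
      ∑ k ∈ Finset.range S.length, (-1 : K) ^ k • e K (S.eraseIdx k) := by
  induction S with
  | nil => simp [boundary, e]
  | cons H S ih =>
    have h : e K (H :: S) = ExteriorAlgebra.ι K (Finsupp.single H (1 : K)) * e K S := by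
      simp [e]
    have h2 : boundary 𝒜 K (ExteriorAlgebra.ι K (Finsupp.single H (1 : K)) * e K S) =
        e K S - ExteriorAlgebra.ι K (Finsupp.single H (1 : K)) * boundary 𝒜 K (e K S) := by
      unfold boundary
      erw [CliffordAlgebra.contractLeft_ι_mul]
      simp
    rw [h, h2, ih, List.length_cons, Finset.sum_range_succ', Finset.mul_sum, sub_eq_add_neg,
      add_comm, ← Finset.sum_neg_distrib]
    congr 1
    · refine Finset.sum_congr rfl fun k _ => ?_
      simp [e, pow_succ]
    · simp

/-- The two-sided ideal generated by `e_S` for `∩ S = ∅` and by `∂ e_S` for `S` dependent. -/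
noncomputable def osIdeal : TwoSidedIdeal (𝒜.Ext K) :=
  TwoSidedIdeal.span
    ({x | ∃ S : List 𝒜.hyperplanes, ¬ (inter S : Set V).Nonempty ∧ x = e K S} ∪
     {x | ∃ S : List 𝒜.hyperplanes, Dependent S ∧ x = boundary 𝒜 K (e K S)})

/-- The Orlik–Solomon algebra. -/
abbrev OSAlgebra : Type _ := 𝒜.Ext K ⧸ (osIdeal 𝒜 K).asIdeal

/-- The natural projection onto the Orlik–Solomon algebra. -/
noncomputable def osProj : 𝒜.Ext K →ₐ[K] 𝒜.OSAlgebra K :=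
  Ideal.Quotient.mkₐ K (osIdeal 𝒜 K).asIdeal

/-- The graded component of degree `p` of the Orlik–Solomon algebra: the image of the
`p`-th exterior power. -/
noncomputable def osDegree (p : ℕ) : Submodule K (𝒜.OSAlgebra K) :=
  (⋀[K]^p (𝒜.hyperplanes →₀ K)).map (osProj 𝒜 K).toLinearMap

variable {𝒜}

/-- `E_X`, the span of the `e_S` with `∩ S = X`. -/
noncomputable def extComponent (X : 𝒜.IntersectionPoset) : Submodule K (𝒜.Ext K) :=
  Submodule.span K {x | ∃ S : List 𝒜.hyperplanes, inter S = X.1 ∧ x = e K S}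

/-- `A_X`, the image of `E_X` in the Orlik–Solomon algebra. -/
noncomputable def osComponent (X : 𝒜.IntersectionPoset) : Submodule K (𝒜.OSAlgebra K) :=
  (extComponent K X).map (osProj 𝒜 K).toLinearMap

/-- The (external) direct sum of the modules `A_X` over `X ∈ I`. -/
abbrev OSSum (I : Set 𝒜.IntersectionPoset) : Type _ := ⨁ X : I, osComponent K X.1

/-- The sum of the inclusions `A_X → A(𝒜)`. -/
noncomputable def osSumMap (I : Set 𝒜.IntersectionPoset) : OSSum K I →ₗ[K] 𝒜.OSAlgebra K := by
  classical exact DirectSum.coeLinearMap fun X : I => osComponent K X.1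

/-- The degree `p` part of `⨁ A_X`: all coordinates have degree `p` in `A(𝒜)`. -/
noncomputable def osSumDegree (I : Set 𝒜.IntersectionPoset) (p : ℕ) : Submodule K (OSSum K I) :=
  ⨅ X : I, (osDegree 𝒜 K p).comap
    ((osComponent K X.1).subtype ∘ₗ DirectSum.component K I (fun X => osComponent K X.1) X)

/-- The total degree `p` part of `(⨁_{X ∈ I} A_X) ⊗ (⨁_{Y ∈ J} A_Y)`. -/
noncomputable def osTensorDegree (I J : Set 𝒜.IntersectionPoset) (p : ℕ) :
    Submodule K (OSSum K I ⊗[K] OSSum K J) :=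
  ⨆ (i : ℕ) (j : ℕ) (_ : i + j = p),
    LinearMap.range (TensorProduct.map
      (osSumDegree K I i).subtype (osSumDegree K J j).subtype)

/-- The linear map `(⨁_{X ∈ I} A_X) ⊗ (⨁_{Y ∈ J} A_Y) → A(𝒜)` given by multiplication. -/
noncomputable def kappa (I J : Set 𝒜.IntersectionPoset) :
    OSSum K I ⊗[K] OSSum K J →ₗ[K] 𝒜.OSAlgebra K :=
  TensorProduct.lift
    ((LinearMap.mul K (𝒜.OSAlgebra K)).compl₁₂ (osSumMap K I) (osSumMap K J))

end OrlikSolomon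

end HyperplaneArrangement

/-! Write J for the meet-complement of I. If H contains a nonempty flat ∩S, then adjoining H to S
gives a dependent tuple, and its relation reads e_S = e_H ∂e_S in A; hence also e_H e_S = 0. So over
a nonempty flat, multiplication by such an e_H undoes ∂ (`osProj_e_eq`, `osE_eq_mul_osBoundary`).
Both halves of bijectivity are inductions resting on this.

Surjectivity (`osE_mem_span_productSet`) is by induction on |S|. If X = ∩S is not V, (I1) gives Z ≠
V with, say, I ∩ ⟨X⟩ = ⟨Z⟩; take H containing Z. In e_S = e_H ∂e_S the terms of ∂e_S are, by
induction, combinations of products e_S' e_T' with ∩S' in I and ∩T' in J. Since H and ∩S' both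
contain Z, their intersection is in ⟨Z⟩ and hence in I, so e_H is absorbed into the first factor.

Injectivity (`eq_zero_of_mem_tensorComponent`): A is graded by intersections, so tensors lying over
a single flat X suffice, by induction on codim X. If t has product 0, then (∂ ⊗ 1 + ε 1 ⊗ ∂) t lies
over flats of smaller codimension and has product ∂0 = 0, so it vanishes by induction; multiplying
by e_H in the factor attached to Z recovers t. The sign ε is constant over X because (I3) forces the
intersection in that factor to be exactly Z.

The grading by intersections and the map ∂ on A need homogeneous relations. The Orlik–Solomon ideal
is spanned by monomials of singular tuples and by the e_T ∂e_C e_T' with C a circuit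
(`mem_span_osRelations_of_mem_osIdeal`); the latter are homogeneous because dropping one member of a
circuit leaves its intersection unchanged. -/

namespace HyperplaneArrangement

/-! ### Monomials and the Leibniz rule in the exterior algebra. -/

section Exterior

variable {F V : Type*} [Field F] [AddCommGroup V] [Module F V]
variable {𝒜 : HyperplaneArrangement F V} (K : Type*) [CommRing K]

@[simp]
theorem e_nil : e K ([] : List 𝒜.hyperplanes) = 1 := by simp [e]

theorem e_append (S T : List 𝒜.hyperplanes) : e K (S ++ T) = e K S * e K T := by
  simp [e]

theorem e_cons (H : 𝒜.hyperplanes) (S : List 𝒜.hyperplanes) :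
    e K (H :: S) = e K [H] * e K S := by
  rw [← e_append]; rfl

theorem e_singleton (H : 𝒜.hyperplanes) :
    e K [H] = ExteriorAlgebra.ι K (Finsupp.single H (1 : K)) := by
  simp [e]

theorem e_singleton_mul_self (H : 𝒜.hyperplanes) : e K [H] * e K [H] = 0 := by
  rw [e_singleton, ExteriorAlgebra.ι_sq_zero]

theorem e_singleton_mul_swap (H H' : 𝒜.hyperplanes) :
    e K [H] * e K [H'] = -(e K [H'] * e K [H]) := by
  rw [e_singleton, e_singleton, eq_neg_iff_add_eq_zero, ExteriorAlgebra.ι_add_mul_swap]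

theorem e_mul_e_singleton (S : List 𝒜.hyperplanes) (H : 𝒜.hyperplanes) :
    e K S * e K [H] = (-1 : K) ^ S.length • (e K [H] * e K S) := by
  induction S with
  | nil => simp
  | cons H' S ih =>
    rw [e_cons, mul_assoc, ih, mul_smul_comm, ← mul_assoc, e_singleton_mul_swap K H' H,
      List.length_cons, pow_succ, mul_neg_one, neg_smul, neg_mul, smul_neg, mul_assoc]

theorem boundary_e_singleton_mul (H : 𝒜.hyperplanes) (x : 𝒜.Ext K) :
    boundary 𝒜 K (e K [H] * x) = x - e K [H] * boundary 𝒜 K x := by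
  rw [e_singleton]
  unfold boundary
  erw [CliffordAlgebra.contractLeft_ι_mul]
  simp

theorem boundary_e_mul (S : List 𝒜.hyperplanes) (x : 𝒜.Ext K) :
    boundary 𝒜 K (e K S * x) =
      boundary 𝒜 K (e K S) * x + (-1 : K) ^ S.length • (e K S * boundary 𝒜 K x) := by
  induction S with
  | nil => simp [boundary]
  | cons H S ih =>
    rw [e_cons, mul_assoc, boundary_e_singleton_mul, ih, boundary_e_singleton_mul,
      List.length_cons, pow_succ, mul_neg_one, neg_smul, mul_add, sub_mul, mul_smul_comm,
      mul_assoc, mul_assoc]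
    abel

theorem boundary_boundary (x : 𝒜.Ext K) : boundary 𝒜 K (boundary 𝒜 K x) = 0 :=
  CliffordAlgebra.contractLeft_contractLeft _ x

/-- Leibniz for ∂e_S, homogeneous of degree |S| - 1, with the other term killed by ∂² = 0. For empty
S the exponent truncates to 0, but both sides vanish. -/
theorem boundary_boundary_e_mul (S : List 𝒜.hyperplanes) (x : 𝒜.Ext K) :
    boundary 𝒜 K (boundary 𝒜 K (e K S) * x) =
      (-1 : K) ^ (S.length - 1) • (boundary 𝒜 K (e K S) * boundary 𝒜 K x) := by
  have h : ∀ k ∈ Finset.range S.length,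
      boundary 𝒜 K (((-1 : K) ^ k • e K (S.eraseIdx k)) * x) =
        boundary 𝒜 K ((-1 : K) ^ k • e K (S.eraseIdx k)) * x +
        (-1 : K) ^ (S.length - 1) • (((-1 : K) ^ k • e K (S.eraseIdx k)) * boundary 𝒜 K x) := by
    intro k hk
    rw [smul_mul_assoc, map_smul, boundary_e_mul, List.length_eraseIdx_of_lt (by simpa using hk),
      map_smul, smul_add, smul_mul_assoc, smul_mul_assoc, smul_comm ((-1 : K) ^ k)]
  have h2 := boundary_boundary K (e K S)
  rw [boundary_e] at h2 ⊢
  rw [Finset.sum_mul, map_sum, Finset.sum_congr rfl h, Finset.sum_add_distrib, ← Finset.sum_mul,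
    ← map_sum, h2, zero_mul, zero_add, ← Finset.smul_sum, Finset.sum_mul]

theorem span_range_e : Submodule.span K (Set.range (e K : List 𝒜.hyperplanes → 𝒜.Ext K)) = ⊤ := by
  have hmul : ∀ x y, x ∈ Submodule.span K (Set.range (e K : List 𝒜.hyperplanes → 𝒜.Ext K)) →
      y ∈ Submodule.span K (Set.range (e K : List 𝒜.hyperplanes → 𝒜.Ext K)) →
      x * y ∈ Submodule.span K (Set.range (e K : List 𝒜.hyperplanes → 𝒜.Ext K)) := by
    intro x y hx hy
    have := Submodule.mul_mem_mul hx hy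
    rw [Submodule.span_mul_span] at this
    refine Submodule.span_mono ?_ this
    rintro _ ⟨_, ⟨S, rfl⟩, _, ⟨T, rfl⟩, rfl⟩
    exact ⟨S ++ T, e_append K S T⟩
  rw [eq_top_iff]
  rintro x -
  induction x using ExteriorAlgebra.induction with
  | algebraMap r =>
    rw [Algebra.algebraMap_eq_smul_one]
    exact Submodule.smul_mem _ _ (Submodule.subset_span ⟨[], e_nil K⟩)
  | ι v =>
    induction v using Finsupp.induction_linear with
    | zero => simp
    | add u v hu hv => rw [map_add]; exact add_mem hu hv
    | single H r =>
      rw [← mul_one r, ← smul_eq_mul, ← Finsupp.smul_single, map_smul]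
      exact Submodule.smul_mem _ _ (Submodule.subset_span ⟨[H], e_singleton K H⟩)
  | mul x y hx hy => exact hmul _ _ hx hy
  | add x y hx hy => exact add_mem hx hy

end Exterior

/-! ### Gradings of the exterior algebra by a commutative monoid. -/

section Weight

variable {F V : Type*} [Field F] [AddCommGroup V] [Module F V]
variable {𝒜 : HyperplaneArrangement F V} (K : Type*) [CommRing K]
variable {M : Type*} [CommMonoid M] (w : 𝒜.hyperplanes → M)

/-- The linear map sending `e_H` to `e_H` times the weight of `H`. -/
noncomputable def weightMap : (𝒜.hyperplanes →₀ K) →ₗ[K] MonoidAlgebra (𝒜.Ext K) M :=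
  Finsupp.linearCombination K fun H => MonoidAlgebra.single (w H) (e K [H])

theorem weightMap_single (H : 𝒜.hyperplanes) (r : K) :
    weightMap K w (Finsupp.single H r) = r • MonoidAlgebra.single (w H) (e K [H]) := by
  simp [weightMap]

/-- Anticommutativity survives because the weights commute. It supplies the cross terms in
`weightMap_mul_self`. -/
theorem weightMap_mul_swap (u v : 𝒜.hyperplanes →₀ K) :
    weightMap K w u * weightMap K w v + weightMap K w v * weightMap K w u = 0 := by
  induction u using Finsupp.induction_linear with
  | zero => simp
  | add u u' hu hu' =>
    rw [map_add, add_mul, mul_add, add_add_add_comm, hu, hu', add_zero]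
  | single H r =>
    induction v using Finsupp.induction_linear with
    | zero => simp
    | add u u' hu hu' =>
      rw [map_add, add_mul, mul_add, add_add_add_comm, hu, hu', add_zero]
    | single H' r' =>
      rw [weightMap_single, weightMap_single, smul_mul_smul_comm, smul_mul_smul_comm,
        MonoidAlgebra.single_mul_single, MonoidAlgebra.single_mul_single, mul_comm r' r,
        mul_comm (w H') (w H), ← smul_add, ← MonoidAlgebra.single_add,
        e_singleton_mul_swap K H H', neg_add_cancel, MonoidAlgebra.single_zero, smul_zero]

theorem weightMap_mul_self (v : 𝒜.hyperplanes →₀ K) :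
    weightMap K w v * weightMap K w v = 0 := by
  induction v using Finsupp.induction_linear with
  | zero => simp
  | add u v hu hv =>
    rw [map_add, add_mul, mul_add, mul_add, hu, hv, zero_add, add_zero, weightMap_mul_swap]
  | single H r =>
    rw [weightMap_single, smul_mul_smul_comm, MonoidAlgebra.single_mul_single,
      e_singleton_mul_self, MonoidAlgebra.single_zero, smul_zero]

/-- The coaction of the monoid of weights on the exterior algebra. -/
noncomputable def weightCoaction : 𝒜.Ext K →ₐ[K] MonoidAlgebra (𝒜.Ext K) M :=
  ExteriorAlgebra.lift K ⟨weightMap K w, weightMap_mul_self K w⟩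

theorem weightCoaction_e (S : List 𝒜.hyperplanes) :
    weightCoaction K w (e K S) = MonoidAlgebra.single (S.map w).prod (e K S) := by
  induction S with
  | nil => simp [MonoidAlgebra.one_def]
  | cons H S ih =>
    rw [e_cons, map_mul, ih, e_singleton, weightCoaction, ExteriorAlgebra.lift_ι_apply]
    change weightMap K w _ * _ = _
    rw [weightMap_single, one_smul, MonoidAlgebra.single_mul_single, List.map_cons,
      List.prod_cons, e_singleton]

/-- The projection of the exterior algebra onto its part of weight `m`. -/
noncomputable def weightProj (m : M) : 𝒜.Ext K →ₗ[K] 𝒜.Ext K where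
  toFun x := (weightCoaction K w x).coeff m
  map_add' x y := by simp
  map_smul' r x := by simp

open Classical in
theorem weightProj_e (m : M) (S : List 𝒜.hyperplanes) :
    weightProj K w m (e K S) = if (S.map w).prod = m then e K S else 0 := by
  change (weightCoaction K w (e K S)).coeff m = _
  rw [weightCoaction_e]
  simp [Finsupp.single_apply]

end Weight

end HyperplaneArrangement

namespace HyperplaneArrangement

/-! ### Codimension of affine subspaces. -/

section Codim

variable {F V : Type*} [Field F] [AddCommGroup V] [Module F V] [FiniteDimensional F V]

theorem affineCodim_anti {X Y : AffineSubspace F V} (h : X ≤ Y) :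
    affineCodim Y ≤ affineCodim X := by
  have h1 := Submodule.finrank_mono (AffineSubspace.direction_le h)
  have h2 := Submodule.finrank_quotient_add_finrank X.direction
  have h3 := Submodule.finrank_quotient_add_finrank Y.direction
  unfold affineCodim
  omega

theorem affineCodim_inf_le {X Y : AffineSubspace F V}
    (h : ((X ⊓ Y : AffineSubspace F V) : Set V).Nonempty) :
    affineCodim (X ⊓ Y) ≤ affineCodim X + affineCodim Y := by
  obtain ⟨p, hp⟩ := h
  have h1 := Submodule.finrank_quotient_add_finrank X.direction
  have h2 := Submodule.finrank_quotient_add_finrank Y.direction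
  have h3 := Submodule.finrank_quotient_add_finrank (X.direction ⊓ Y.direction)
  have h4 := Submodule.finrank_sup_add_finrank_inf_eq X.direction Y.direction
  have h5 := Submodule.finrank_le (X.direction ⊔ Y.direction)
  unfold affineCodim
  rw [AffineSubspace.direction_inf_of_mem_inf hp]
  omega

theorem eq_of_le_of_affineCodim_le {X Y : AffineSubspace F V} (h : X ≤ Y)
    (hX : (X : Set V).Nonempty) (hc : affineCodim X ≤ affineCodim Y) : X = Y := by
  refine AffineSubspace.eq_of_direction_eq_of_nonempty_of_le ?_ hX h
  refine Submodule.eq_of_le_of_finrank_le (AffineSubspace.direction_le h) ?_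
  have h2 := Submodule.finrank_quotient_add_finrank X.direction
  have h3 := Submodule.finrank_quotient_add_finrank Y.direction
  unfold affineCodim at hc
  omega

theorem affineCodim_top : affineCodim (⊤ : AffineSubspace F V) = 0 := by
  have := Submodule.finrank_quotient_add_finrank (⊤ : AffineSubspace F V).direction
  rw [AffineSubspace.direction_top, finrank_top] at this
  unfold affineCodim
  rw [AffineSubspace.direction_top]
  omega

end Codim

/-! ### Intersections of tuples, singular tuples and circuits. -/

section Inter

variable {F V : Type*} [Field F] [AddCommGroup V] [Module F V]
variable {𝒜 : HyperplaneArrangement F V}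

@[simp]
theorem inter_nil : inter ([] : List 𝒜.hyperplanes) = ⊤ := rfl

theorem inter_cons (H : 𝒜.hyperplanes) (S : List 𝒜.hyperplanes) :
    inter (H :: S) = H.1 ⊓ inter S := rfl

theorem inter_append (S T : List 𝒜.hyperplanes) : inter (S ++ T) = inter S ⊓ inter T := by
  induction S with
  | nil => simp
  | cons H S ih => rw [List.cons_append, inter_cons, ih, inter_cons, inf_assoc]

theorem inter_eraseIdx_le (S : List 𝒜.hyperplanes) (k : ℕ) :
    inter S ≤ inter (S.eraseIdx k) := by
  induction S generalizing k with
  | nil => simp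
  | cons H S ih =>
    cases k with
    | zero => exact inf_le_right
    | succ k => exact inf_le_inf_left _ (ih k)

theorem affineCodim_inter_le [FiniteDimensional F V] (S : List 𝒜.hyperplanes)
    (h : (inter S : Set V).Nonempty) : affineCodim (inter S) ≤ S.length := by
  induction S with
  | nil => simp [affineCodim_top]
  | cons H S ih =>
    have h1 := affineCodim_inf_le (X := H.1) (Y := inter S) h
    have h2 := ih (h.mono inf_le_right)
    rw [𝒜.codim_eq_one _ H.2] at h1
    rw [inter_cons, List.length_cons]
    omega

/-- A tuple is singular if its intersection is empty or of codimension less than its length. -/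
def Singular (S : List 𝒜.hyperplanes) : Prop :=
  ¬ (inter S : Set V).Nonempty ∨ Dependent S

/-- Intersecting with |S| more hyperplanes raises the codimension by at most |S|, so a deficit of T
persists unless the intersection becomes empty. -/
theorem Singular.append_left [FiniteDimensional F V] {T : List 𝒜.hyperplanes} (h : Singular T)
    (S : List 𝒜.hyperplanes) : Singular (S ++ T) := by
  by_cases hn : (inter (S ++ T) : Set V).Nonempty
  · rw [inter_append] at hn
    obtain h | h := h
    · exact absurd (hn.mono inf_le_right) h
    · refine Or.inr ⟨by rwa [inter_append], ?_⟩
      have h1 := affineCodim_inf_le hn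
      have h2 := affineCodim_inter_le S (hn.mono inf_le_left)
      have h3 := h.2
      rw [inter_append, List.length_append]
      omega
  · exact Or.inl hn

theorem Singular.append_right [FiniteDimensional F V] {T : List 𝒜.hyperplanes} (h : Singular T)
    (S : List 𝒜.hyperplanes) : Singular (T ++ S) := by
  have := h.append_left S
  unfold Singular Dependent at this ⊢
  rwa [inter_append, List.length_append, inf_comm, add_comm, ← inter_append,
    ← List.length_append] at this

theorem length_eq_of_not_singular [FiniteDimensional F V] {S : List 𝒜.hyperplanes}
    (h : ¬ Singular S) : S.length = affineCodim (inter S) := by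
  unfold Singular Dependent at h
  push Not at h
  exact le_antisymm (h.2 h.1) (affineCodim_inter_le S h.1)

/-- A circuit is a minimal dependent tuple. -/
def Circuit (S : List 𝒜.hyperplanes) : Prop :=
  Dependent S ∧ ∀ k < S.length, ¬ Dependent (S.eraseIdx k)

/-- The shortened tuple is independent, so its codimension is already |S| - 1, the most that ∩S can
have. This makes ∂e_S homogeneous for the grading by intersections. -/
theorem Circuit.inter_eraseIdx [FiniteDimensional F V] {S : List 𝒜.hyperplanes} (h : Circuit S)
    {k : ℕ} (hk : k < S.length) : inter (S.eraseIdx k) = inter S := by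
  have hn := h.1.1.mono (inter_eraseIdx_le S k)
  have h1 : ¬ Dependent (S.eraseIdx k) := h.2 k hk
  unfold Dependent at h1
  push Not at h1
  have h2 := h1 hn
  rw [List.length_eraseIdx_of_lt hk] at h2
  have h3 := h.1.2
  exact (eq_of_le_of_affineCodim_le (inter_eraseIdx_le S k) h.1.1 (by omega)).symm

end Inter

/-! ### A homogeneous spanning set of the Orlik–Solomon ideal. -/

section Relations

variable {F V : Type*} [Field F] [AddCommGroup V] [Module F V]
variable {𝒜 : HyperplaneArrangement F V} (K : Type*) [CommRing K]

theorem e_eraseIdx (S : List 𝒜.hyperplanes) {k : ℕ} (hk : k < S.length) :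
    e K S = (-1 : K) ^ k • (e K [S[k]] * e K (S.eraseIdx k)) := by
  have h : e K S = e K (S.take k) * (e K [S[k]] * e K (S.drop (k + 1))) := by
    rw [← e_cons, ← e_append]
    congr 1
    rw [← List.drop_eq_getElem_cons hk, List.take_append_drop]
  rw [List.eraseIdx_eq_take_drop_succ, e_append, h, ← mul_assoc, e_mul_e_singleton,
    smul_mul_assoc, mul_assoc, List.length_take_of_le hk.le]

theorem e_mul_boundary_mul_e (S T T' : List 𝒜.hyperplanes) :
    e K T * boundary 𝒜 K (e K S) * e K T' =
      ∑ k ∈ Finset.range S.length, (-1 : K) ^ k • e K (T ++ S.eraseIdx k ++ T') := by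
  rw [boundary_e, Finset.mul_sum, Finset.sum_mul]
  refine Finset.sum_congr rfl fun k _ => ?_
  rw [e_append, e_append, mul_smul_comm, smul_mul_assoc]

variable (𝒜) in
/-- A set of homogeneous elements spanning the Orlik–Solomon ideal as a module. -/
def osRelations : Set (𝒜.Ext K) :=
  {x | ∃ S : List 𝒜.hyperplanes, Singular S ∧ x = e K S} ∪
  {x | ∃ T C T' : List 𝒜.hyperplanes, Circuit C ∧ x = e K T * boundary 𝒜 K (e K C) * e K T'}

variable [FiniteDimensional F V]

theorem e_mul_mem_span_osRelations (S : List 𝒜.hyperplanes) {x : 𝒜.Ext K}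
    (hx : x ∈ Submodule.span K (osRelations 𝒜 K)) :
    e K S * x ∈ Submodule.span K (osRelations 𝒜 K) := by
  have := Submodule.mem_map_of_mem (f := LinearMap.mulLeft K (e K S)) hx
  rw [Submodule.map_span] at this
  refine Submodule.span_mono ?_ this
  rintro _ ⟨_, ⟨T, hT, rfl⟩ | ⟨T, C, T', hC, rfl⟩, rfl⟩
  · exact Or.inl ⟨S ++ T, hT.append_left S, by simp [e_append]⟩
  · exact Or.inr ⟨S ++ T, C, T', hC, by simp [e_append, mul_assoc]⟩

theorem mul_e_mem_span_osRelations (S : List 𝒜.hyperplanes) {x : 𝒜.Ext K}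
    (hx : x ∈ Submodule.span K (osRelations 𝒜 K)) :
    x * e K S ∈ Submodule.span K (osRelations 𝒜 K) := by
  have := Submodule.mem_map_of_mem (f := LinearMap.mulRight K (e K S)) hx
  rw [Submodule.map_span] at this
  refine Submodule.span_mono ?_ this
  rintro _ ⟨_, ⟨T, hT, rfl⟩ | ⟨T, C, T', hC, rfl⟩, rfl⟩
  · exact Or.inl ⟨T ++ S, hT.append_right S, by simp [e_append]⟩
  · exact Or.inr ⟨T, C, T' ++ S, hC, by simp [e_append, mul_assoc]⟩

/-- A dependent S that is not a circuit has a dependent subtuple T missing one H. Up to sign, ∂e_S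
is e_T - e_H ∂e_T: the first term is a singular monomial, the second is covered by induction. -/
theorem boundary_mem_span_osRelations {S : List 𝒜.hyperplanes} (hS : Dependent S) :
    boundary 𝒜 K (e K S) ∈ Submodule.span K (osRelations 𝒜 K) := by
  induction hn : S.length generalizing S with
  | zero => exact absurd hS.2 (by omega)
  | succ n ih =>
    by_cases hC : Circuit S
    · exact Submodule.subset_span (Or.inr ⟨[], S, [], hC, by simp⟩)
    · obtain ⟨k, hk, hd⟩ : ∃ k < S.length, Dependent (S.eraseIdx k) := by
        by_contra! h
        exact hC ⟨hS, h⟩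
      rw [e_eraseIdx K S hk, map_smul, boundary_e_singleton_mul]
      refine Submodule.smul_mem _ _ (sub_mem (Submodule.subset_span
        (Or.inl ⟨_, Or.inr hd, rfl⟩)) (e_mul_mem_span_osRelations K _ (ih hd ?_)))
      rw [List.length_eraseIdx_of_lt hk]
      omega

/-- The span is stable under multiplication by monomials on both sides, and monomials span the
algebra, so it absorbs products like an ideal. -/
theorem mem_span_osRelations_of_mem_osIdeal {x : 𝒜.Ext K} (hx : x ∈ osIdeal 𝒜 K) :
    x ∈ Submodule.span K (osRelations 𝒜 K) := by
  induction hx using TwoSidedIdeal.span_induction with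
  | mem x h =>
    obtain ⟨S, hS, rfl⟩ | ⟨S, hS, rfl⟩ := h
    · exact Submodule.subset_span (Or.inl ⟨S, Or.inl hS, rfl⟩)
    · exact boundary_mem_span_osRelations K hS
  | zero => exact zero_mem _
  | add x y _ _ hx hy => exact add_mem hx hy
  | neg x _ hx => exact neg_mem hx
  | left_absorb a x _ hx =>
    have ha : a ∈ Submodule.span K (Set.range (e K : List 𝒜.hyperplanes → 𝒜.Ext K)) := by
      rw [span_range_e]; trivial
    induction ha using Submodule.span_induction with
    | mem a h => obtain ⟨S, rfl⟩ := h; exact e_mul_mem_span_osRelations K S hx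
    | zero => simp
    | add a b _ _ ha hb => rw [add_mul]; exact add_mem ha hb
    | smul r a _ ha => rw [smul_mul_assoc]; exact Submodule.smul_mem _ _ ha
  | right_absorb a x _ hx =>
    have ha : a ∈ Submodule.span K (Set.range (e K : List 𝒜.hyperplanes → 𝒜.Ext K)) := by
      rw [span_range_e]; trivial
    induction ha using Submodule.span_induction with
    | mem a h => obtain ⟨S, rfl⟩ := h; exact mul_e_mem_span_osRelations K S hx
    | zero => simp
    | add a b _ _ ha hb => rw [mul_add]; exact add_mem ha hb
    | smul r a _ ha => rw [mul_smul_comm]; exact Submodule.smul_mem _ _ ha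

end Relations

/-! ### Relations in the Orlik–Solomon algebra and maps out of it. -/

section Quotient

variable {F V : Type*} [Field F] [AddCommGroup V] [Module F V]
variable {𝒜 : HyperplaneArrangement F V} (K : Type*) [CommRing K]

variable (𝒜) in
theorem osProj_surjective : Function.Surjective (osProj 𝒜 K) :=
  Ideal.Quotient.mkₐ_surjective K _

theorem osProj_eq_zero_iff {x : 𝒜.Ext K} : osProj 𝒜 K x = 0 ↔ x ∈ osIdeal 𝒜 K := by
  rw [← TwoSidedIdeal.mem_asIdeal]
  exact Ideal.Quotient.eq_zero_iff_mem

theorem osProj_boundary_of_dependent {S : List 𝒜.hyperplanes} (hS : Dependent S) :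
    osProj 𝒜 K (boundary 𝒜 K (e K S)) = 0 :=
  (osProj_eq_zero_iff K).2 (TwoSidedIdeal.subset_span (Or.inr ⟨S, hS, rfl⟩))

theorem osProj_of_inter_empty {S : List 𝒜.hyperplanes} (hS : ¬ (inter S : Set V).Nonempty) :
    osProj 𝒜 K (e K S) = 0 :=
  (osProj_eq_zero_iff K).2 (TwoSidedIdeal.subset_span (Or.inl ⟨S, hS, rfl⟩))

/-- In the dependent case, with H the head of S, applying ∂ to e_H e_S = 0 gives e_S = e_H ∂e_S, a
multiple of a relation. -/
theorem osProj_of_singular {S : List 𝒜.hyperplanes} (hS : Singular S) :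
    osProj 𝒜 K (e K S) = 0 := by
  obtain h | h := hS
  · exact osProj_of_inter_empty K h
  · cases S with
    | nil => exact absurd h.2 (by simp)
    | cons H S =>
      have h1 : boundary 𝒜 K (e K [H] * e K (H :: S)) = 0 := by
        rw [e_cons K H S, ← mul_assoc, e_singleton_mul_self, zero_mul, map_zero]
      rw [boundary_e_singleton_mul, sub_eq_zero] at h1
      rw [h1, map_mul, osProj_boundary_of_dependent K h, mul_zero]

variable [FiniteDimensional F V]

/-- Adjoining H lengthens S without changing the intersection, so H :: S is dependent, and ∂(e_H
e_S) = e_S - e_H ∂e_S is a relation. -/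
theorem osProj_e_eq (S : List 𝒜.hyperplanes) (hS : (inter S : Set V).Nonempty)
    (H : 𝒜.hyperplanes) (hH : inter S ≤ H.1) :
    osProj 𝒜 K (e K S) = osProj 𝒜 K (e K [H]) * osProj 𝒜 K (boundary 𝒜 K (e K S)) := by
  have hi : inter (H :: S) = inter S := by rw [inter_cons, inf_eq_right.2 hH]
  have hd : Dependent (H :: S) :=
    ⟨by rwa [hi], by rw [hi, List.length_cons]; have := affineCodim_inter_le S hS; omega⟩
  have := osProj_boundary_of_dependent K hd
  rwa [e_cons, boundary_e_singleton_mul, map_sub, map_mul, sub_eq_zero] at this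

variable {N : Type*} [AddCommGroup N] [Module K N]

/-- Linear maps killing the homogeneous relations descend to the Orlik–Solomon algebra. -/
noncomputable def osLift (f : 𝒜.Ext K →ₗ[K] N) (hf : ∀ x ∈ osRelations 𝒜 K, f x = 0) :
    𝒜.OSAlgebra K →ₗ[K] N :=
  (LinearMap.ker (osProj 𝒜 K).toLinearMap).liftQ f (by
    intro x hx
    have h2 : Submodule.span K (osRelations 𝒜 K) ≤ LinearMap.ker f := Submodule.span_le.2 hf
    exact h2 (mem_span_osRelations_of_mem_osIdeal K ((osProj_eq_zero_iff K).1 hx))) ∘ₗ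
  ((osProj 𝒜 K).toLinearMap.quotKerEquivOfSurjective (osProj_surjective 𝒜 K)).symm.toLinearMap

theorem osLift_osProj (f : 𝒜.Ext K →ₗ[K] N) (hf : ∀ x ∈ osRelations 𝒜 K, f x = 0)
    (x : 𝒜.Ext K) : osLift K f hf (osProj 𝒜 K x) = f x := by
  have : ((osProj 𝒜 K).toLinearMap.quotKerEquivOfSurjective (osProj_surjective 𝒜 K)).symm
      (osProj 𝒜 K x) = Submodule.Quotient.mk x := by
    rw [LinearEquiv.symm_apply_eq]; rfl
  rw [osLift, LinearMap.comp_apply, LinearEquiv.coe_coe, this, Submodule.liftQ_apply]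

end Quotient

end HyperplaneArrangement

namespace HyperplaneArrangement

/-! ### Projections and the boundary map on the Orlik–Solomon algebra. -/

section Operators

variable {F V : Type*} [Field F] [AddCommGroup V] [Module F V]
variable {𝒜 : HyperplaneArrangement F V} (K : Type*) [CommRing K]

/-- The image of `e_S` in the Orlik–Solomon algebra. -/
noncomputable def osE (S : List 𝒜.hyperplanes) : 𝒜.OSAlgebra K := osProj 𝒜 K (e K S)

@[simp]
theorem osE_nil : osE K ([] : List 𝒜.hyperplanes) = 1 := by simp [osE]

theorem osE_append (S T : List 𝒜.hyperplanes) : osE K (S ++ T) = osE K S * osE K T := by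
  rw [osE, e_append, map_mul]; rfl

theorem osE_cons (H : 𝒜.hyperplanes) (S : List 𝒜.hyperplanes) :
    osE K (H :: S) = osE K [H] * osE K S := by
  rw [← osE_append]; rfl

theorem osE_mul_osE_singleton (S : List 𝒜.hyperplanes) (H : 𝒜.hyperplanes) :
    osE K [H] * osE K S = (-1 : K) ^ S.length • (osE K S * osE K [H]) := by
  have h : e K [H] * e K S = (-1 : K) ^ S.length • (e K S * e K [H]) := by
    rw [e_mul_e_singleton, smul_smul, ← mul_pow]; simp
  unfold osE
  rw [← map_mul, h, map_smul, map_mul]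

theorem osProj_boundary_e (S : List 𝒜.hyperplanes) :
    osProj 𝒜 K (boundary 𝒜 K (e K S)) =
      ∑ k ∈ Finset.range S.length, (-1 : K) ^ k • osE K (S.eraseIdx k) := by
  rw [boundary_e, map_sum]
  simp only [map_smul]
  rfl

variable (𝒜) in
theorem span_range_osE :
    Submodule.span K (Set.range (osE K : List 𝒜.hyperplanes → 𝒜.OSAlgebra K)) = ⊤ := by
  have h : Set.range (osE K : List 𝒜.hyperplanes → 𝒜.OSAlgebra K) =
      (osProj 𝒜 K).toLinearMap '' Set.range (e K) := by
    rw [← Set.range_comp]; rfl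
  rw [h, ← Submodule.map_span, span_range_e, Submodule.map_top, LinearMap.range_eq_top]
  exact osProj_surjective 𝒜 K

theorem osComponent_eq_span (X : 𝒜.IntersectionPoset) :
    osComponent K X = Submodule.span K {x | ∃ S : List 𝒜.hyperplanes, inter S = X.1 ∧
      x = osE K S} := by
  rw [osComponent, extComponent, Submodule.map_span]
  congr 1
  ext x
  constructor
  · rintro ⟨_, ⟨S, hS, rfl⟩, rfl⟩; exact ⟨S, hS, rfl⟩
  · rintro ⟨S, hS, rfl⟩; exact ⟨_, ⟨S, hS, rfl⟩, rfl⟩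

theorem osE_mem_osComponent {X : 𝒜.IntersectionPoset} {S : List 𝒜.hyperplanes}
    (h : inter S = X.1) : osE K S ∈ osComponent K X := by
  rw [osComponent_eq_span]
  exact Submodule.subset_span ⟨S, h, rfl⟩

variable {M : Type*} [CommMonoid M] (w : 𝒜.hyperplanes → M)

/-- All terms of the expanded relation have the same weight, so a projection keeps all of them or
none. -/
theorem weightProj_circuit {C : List 𝒜.hyperplanes} {n : M}
    (hC : ∀ k < C.length, ((C.eraseIdx k).map w).prod = n) (T T' : List 𝒜.hyperplanes) (m : M) :
    weightProj K w m (e K T * boundary 𝒜 K (e K C) * e K T') =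
      e K T * boundary 𝒜 K (e K C) * e K T' ∨
    weightProj K w m (e K T * boundary 𝒜 K (e K C) * e K T') = 0 := by
  classical
  rw [e_mul_boundary_mul_e, map_sum]
  have h : ∀ k ∈ Finset.range C.length,
      weightProj K w m ((-1 : K) ^ k • e K (T ++ C.eraseIdx k ++ T')) =
      if (T.map w).prod * n * (T'.map w).prod = m then
        (-1 : K) ^ k • e K (T ++ C.eraseIdx k ++ T') else 0 := by
    intro k hk
    rw [map_smul, weightProj_e, List.map_append, List.map_append, List.prod_append,
      List.prod_append, hC k (by simpa using hk), smul_ite, smul_zero]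
  rw [Finset.sum_congr rfl h]
  split_ifs
  · exact Or.inl rfl
  · exact Or.inr (by simp)

theorem osProj_of_mem_osRelations {x : 𝒜.Ext K} (hx : x ∈ osRelations 𝒜 K) :
    osProj 𝒜 K x = 0 := by
  obtain ⟨S, hS, rfl⟩ | ⟨T, C, T', hC, rfl⟩ := hx
  · exact osProj_of_singular K hS
  · rw [map_mul, map_mul, osProj_boundary_of_dependent K hC.1, mul_zero, zero_mul]

variable (F V) in
/-- The affine subspaces of `V` as a monoid under intersection. -/
@[ext]
structure InterMonoid where
  /-- The underlying affine subspace. -/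
  carrier : AffineSubspace F V

instance : CommMonoid (InterMonoid F V) where
  mul X Y := ⟨X.carrier ⊓ Y.carrier⟩
  one := ⟨⊤⟩
  mul_assoc X Y Z := InterMonoid.ext (inf_assoc X.carrier Y.carrier Z.carrier)
  one_mul X := InterMonoid.ext (top_inf_eq X.carrier)
  mul_one X := InterMonoid.ext (inf_top_eq X.carrier)
  mul_comm X Y := InterMonoid.ext (inf_comm X.carrier Y.carrier)

/-- The weight of a hyperplane in the monoid of affine subspaces. -/
def interWeight (H : 𝒜.hyperplanes) : InterMonoid F V := ⟨H.1⟩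

theorem prod_interWeight (S : List 𝒜.hyperplanes) : (S.map interWeight).prod = ⟨inter S⟩ := by
  induction S with
  | nil => rfl
  | cons H S ih => rw [List.map_cons, List.prod_cons, ih]; rfl

/-- The boundary map on the part of the exterior algebra spanned by the `e_S` with
`∩ S ≠ ∅`, extended by zero. -/
noncomputable def extBoundary : 𝒜.Ext K →ₗ[K] 𝒜.OSAlgebra K :=
  (osProj 𝒜 K).toLinearMap ∘ₗ boundary 𝒜 K ∘ₗ
    (LinearMap.id - weightProj K interWeight ⟨⊥⟩)

variable [FiniteDimensional F V]

/-- The projection of the Orlik–Solomon algebra onto its part of weight `m`, for weights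
that are homogeneous on circuits. -/
noncomputable def osWeightProj
    (hw : ∀ C : List 𝒜.hyperplanes, Circuit C →
      ∃ n, ∀ k < C.length, ((C.eraseIdx k).map w).prod = n)
    (m : M) : 𝒜.OSAlgebra K →ₗ[K] 𝒜.OSAlgebra K :=
  osLift K ((osProj 𝒜 K).toLinearMap ∘ₗ weightProj K w m) (by
    classical
    intro x hx
    rw [LinearMap.comp_apply, AlgHom.toLinearMap_apply]
    have hx0 := osProj_of_mem_osRelations K hx
    obtain ⟨S, hS, rfl⟩ | ⟨T, C, T', hC, rfl⟩ := hx
    · rw [weightProj_e]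
      split_ifs
      · exact hx0
      · simp
    · obtain ⟨n, hn⟩ := hw C hC
      obtain h | h := weightProj_circuit K w hn T T' m
      · rwa [h]
      · rw [h, map_zero])

open Classical in
theorem osWeightProj_osE
    (hw : ∀ C : List 𝒜.hyperplanes, Circuit C →
      ∃ n, ∀ k < C.length, ((C.eraseIdx k).map w).prod = n)
    (m : M) (S : List 𝒜.hyperplanes) :
    osWeightProj K w hw m (osE K S) = if (S.map w).prod = m then osE K S else 0 := by
  rw [osE, osWeightProj, osLift_osProj, LinearMap.comp_apply, AlgHom.toLinearMap_apply,
    weightProj_e]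
  split_ifs <;> simp

/-- The projection of the Orlik–Solomon algebra onto the part spanned by the `e_S` with
`∩ S = X`. -/
noncomputable def interProj (X : AffineSubspace F V) : 𝒜.OSAlgebra K →ₗ[K] 𝒜.OSAlgebra K :=
  osWeightProj K interWeight
    (fun C hC => ⟨⟨inter C⟩, fun k hk => by rw [prod_interWeight, hC.inter_eraseIdx hk]⟩) ⟨X⟩

open Classical in
theorem interProj_osE (X : AffineSubspace F V) (S : List 𝒜.hyperplanes) :
    interProj K X (osE K S) = if inter S = X then osE K S else 0 := by
  rw [interProj, osWeightProj_osE, prod_interWeight]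
  simp only [InterMonoid.mk.injEq]

/-- The projection of the Orlik–Solomon algebra onto its part of degree `p`. -/
noncomputable def degreeProj (p : ℕ) : 𝒜.OSAlgebra K →ₗ[K] 𝒜.OSAlgebra K :=
  osWeightProj K (fun _ => Multiplicative.ofAdd 1)
    (fun C _ => ⟨Multiplicative.ofAdd (C.length - 1), fun k hk => by
      rw [List.map_const', List.prod_replicate, List.length_eraseIdx_of_lt hk, ← ofAdd_nsmul]
      simp⟩) (Multiplicative.ofAdd p)

theorem degreeProj_osE (p : ℕ) (S : List 𝒜.hyperplanes) :
    degreeProj K p (osE K S) = if S.length = p then osE K S else 0 := by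
  classical
  rw [degreeProj, osWeightProj_osE, List.map_const', List.prod_replicate, ← ofAdd_nsmul]
  simp

/-- Relations of weight ∅ are removed by the projection. Otherwise a singular monomial is dependent
and its boundary is a relation, while in ∂(e_T ∂e_C e_T') both Leibniz terms keep the factor ∂e_C,
since ∂² = 0. -/
theorem extBoundary_eq_zero {x : 𝒜.Ext K} (hx : x ∈ osRelations 𝒜 K) :
    extBoundary K x = 0 := by
  classical
  rw [extBoundary, LinearMap.comp_apply, LinearMap.comp_apply, AlgHom.toLinearMap_apply,
    LinearMap.sub_apply, LinearMap.id_apply]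
  obtain ⟨S, hS, rfl⟩ | ⟨T, C, T', hC, rfl⟩ := hx
  · rw [weightProj_e, prod_interWeight]
    obtain h | h := hS
    · rw [not_ne_iff.1 (mt (AffineSubspace.nonempty_iff_ne_bot _).2 h)]
      simp
    · rw [if_neg, sub_zero, osProj_boundary_of_dependent K h]
      exact fun h' => (AffineSubspace.nonempty_iff_ne_bot _).1 h.1 (InterMonoid.mk.inj h')
  · obtain h | h := weightProj_circuit K interWeight (n := ⟨inter C⟩)
      (fun k hk => by rw [prod_interWeight, hC.inter_eraseIdx hk]) T T' ⟨⊥⟩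
    · rw [h, sub_self, map_zero, map_zero]
    · rw [h, sub_zero, mul_assoc, boundary_e_mul, boundary_boundary_e_mul]
      simp [osProj_boundary_of_dependent K hC.1]

/-- The boundary map of the Orlik–Solomon algebra as a module. It is a derivation only on
products `e_S e_T` with `∩ S ∩ T ≠ ∅`. -/
noncomputable def osBoundary : 𝒜.OSAlgebra K →ₗ[K] 𝒜.OSAlgebra K :=
  osLift K (extBoundary K) fun _ => extBoundary_eq_zero K

theorem osBoundary_osE {S : List 𝒜.hyperplanes} (hS : (inter S : Set V).Nonempty) :
    osBoundary K (osE K S) = osProj 𝒜 K (boundary 𝒜 K (e K S)) := by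
  classical
  rw [osBoundary, osE, osLift_osProj, extBoundary, LinearMap.comp_apply, LinearMap.comp_apply,
    LinearMap.sub_apply, weightProj_e, if_neg]
  · simp
  · rw [prod_interWeight]
    exact fun h' => (AffineSubspace.nonempty_iff_ne_bot _).1 hS (InterMonoid.mk.inj h')

theorem osBoundary_osE_mul_osE {S T : List 𝒜.hyperplanes}
    (h : (inter S ⊓ inter T : Set V).Nonempty) :
    osBoundary K (osE K S * osE K T) =
      osBoundary K (osE K S) * osE K T +
        (-1 : K) ^ S.length • (osE K S * osBoundary K (osE K T)) := by
  rw [← osE_append, osBoundary_osE K (by rwa [inter_append]), e_append, boundary_e_mul,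
    osBoundary_osE K (h.mono Set.inter_subset_left),
    osBoundary_osE K (h.mono Set.inter_subset_right), map_add, map_smul, map_mul, map_mul]
  rfl

theorem osE_eq_mul_osBoundary {S : List 𝒜.hyperplanes} (hS : (inter S : Set V).Nonempty)
    (H : 𝒜.hyperplanes) (hH : inter S ≤ H.1) :
    osE K [H] * osBoundary K (osE K S) = osE K S := by
  rw [osBoundary_osE K hS]
  exact (osProj_e_eq K S hS H hH).symm

theorem osE_singleton_mul_eq_zero {S : List 𝒜.hyperplanes} (hS : (inter S : Set V).Nonempty)
    (H : 𝒜.hyperplanes) (hH : inter S ≤ H.1) :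
    osE K [H] * osE K S = 0 := by
  rw [← osE_eq_mul_osBoundary K hS H hH, ← mul_assoc]
  have : osE K [H] * osE K [H] = 0 := by
    unfold osE
    rw [← map_mul, e_singleton_mul_self, map_zero]
  rw [this, zero_mul]

end Operators

end HyperplaneArrangement

namespace HyperplaneArrangement

/-! ### Consequences of the axioms of an ideal decomposition. -/

section Decomposition

variable {F V : Type*} [Field F] [AddCommGroup V] [Module F V]
variable {𝒜 : HyperplaneArrangement F V}

/-- The intersection of a hyperplane with an element of the intersection poset. -/
theorem exists_poset_inf (H : 𝒜.hyperplanes) (Y : 𝒜.IntersectionPoset)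
    (h : ((H.1 ⊓ Y.1 : AffineSubspace F V) : Set V).Nonempty) :
    ∃ W : 𝒜.IntersectionPoset, W.1 = H.1 ⊓ Y.1 := by
  classical
  obtain ⟨Y, hY, B, hB, rfl⟩ := Y
  refine ⟨⟨_, h, insert H.1 B, ?_, ?_⟩, rfl⟩
  · exact Finset.insert_subset H.2 hB
  · rw [Finset.inf_insert, id]

theorem exists_poset_inter (S : List 𝒜.hyperplanes) (h : (inter S : Set V).Nonempty) :
    ∃ W : 𝒜.IntersectionPoset, W.1 = inter S := by
  induction S with
  | nil => exact ⟨⊥, rfl⟩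
  | cons H S ih =>
    obtain ⟨Y, hY⟩ := ih (h.mono inf_le_right)
    rw [inter_cons, ← hY] at h ⊢
    exact exists_poset_inf H Y h

theorem exists_hyperplane_of_ne_bot {Z : 𝒜.IntersectionPoset} (hZ : Z ≠ ⊥) :
    ∃ H : 𝒜.hyperplanes, Z.1 ≤ H.1 := by
  obtain ⟨Z, hne, B, hB, rfl⟩ := Z
  obtain rfl | ⟨H, hH⟩ := B.eq_empty_or_nonempty
  · exact absurd rfl hZ
  · exact ⟨⟨H, hB hH⟩, Finset.inf_le (f := id) hH⟩

instance : Finite 𝒜.IntersectionPoset := by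
  refine Finite.of_injective
    (fun X => (⟨X.2.2.choose, Finset.mem_powerset.2 X.2.2.choose_spec.1⟩ :
      𝒜.hyperplanes.powerset)) fun X Y h => Subtype.ext ?_
  exact X.2.2.choose_spec.2.symm.trans
    ((congrArg (fun B => B.1.inf id) h).trans Y.2.2.choose_spec.2)

/-- Both H and Y contain Z, so their intersection is nonempty and belongs to ⟨Z⟩, a subset of I.
This lets e_H be absorbed into a factor over I. -/
theorem exists_mem_inf {I : Set 𝒜.IntersectionPoset} {X Z : 𝒜.IntersectionPoset}
    (h : I ∩ Set.Iic X = Set.Iic Z) {H : 𝒜.hyperplanes} (hH : Z.1 ≤ H.1)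
    {Y : 𝒜.IntersectionPoset} (hY : Y ∈ I) (hYX : X.1 ≤ Y.1) : ∃ W ∈ I, W.1 = H.1 ⊓ Y.1 := by
  have hYZ : Z.1 ≤ Y.1 := (h ▸ (⟨hY, hYX⟩ : Y ∈ I ∩ Set.Iic X) : Y ∈ Set.Iic Z)
  have hle : Z.1 ≤ H.1 ⊓ Y.1 := le_inf hH hYZ
  obtain ⟨W, hW⟩ := exists_poset_inf H Y (Z.2.1.mono hle)
  refine ⟨W, ?_, hW⟩
  have : W ∈ Set.Iic Z := by rw [← hW] at hle; exact hle
  rw [← h] at this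
  exact this.1

variable {I J : Set 𝒜.IntersectionPoset}

theorem IsIdealDecomposition.bot_mem_left
    (hD : IsIdealDecomposition ![I, J]) : ⊥ ∈ I := by
  obtain ⟨⟨Y, hY⟩, h⟩ := hD.ideal 0
  exact h bot_le hY

theorem IsIdealDecomposition.bot_mem_right
    (hD : IsIdealDecomposition ![I, J]) : ⊥ ∈ J := by
  obtain ⟨⟨Y, hY⟩, h⟩ := hD.ideal 1
  exact h bot_le hY

theorem IsIdealDecomposition.principal
    (hD : IsIdealDecomposition ![I, J]) {X : 𝒜.IntersectionPoset} (hX : X ≠ ⊥) :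
    (∃ Z, Z ≠ ⊥ ∧ I ∩ Set.Iic X = Set.Iic Z) ∨ (∃ Z, Z ≠ ⊥ ∧ J ∩ Set.Iic X = Set.Iic Z) := by
  obtain ⟨j, hj⟩ := hD.meet X hX
  fin_cases j
  · exact Or.inl hj
  · exact Or.inr hj

theorem IsIdealDecomposition.nonempty_inf
    (hD : IsIdealDecomposition ![I, J]) {X Y : 𝒜.IntersectionPoset} (hX : X ∈ I) (hY : Y ∈ J) :
    ((X.1 ⊓ Y.1 : AffineSubspace F V) : Set V).Nonempty := by
  refine (hD.join ![X, Y] ?_).mono ?_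
  · intro j; fin_cases j <;> assumption
  · exact (le_inf (iInf_le _ (0 : Fin 2)) (iInf_le _ (1 : Fin 2)) :
      (⨅ j, (![X, Y] j).1) ≤ X.1 ⊓ Y.1)

theorem IsIdealDecomposition.codim_inf
    (hD : IsIdealDecomposition ![I, J]) {X Y : 𝒜.IntersectionPoset} (hX : X ∈ I) (hY : Y ∈ J) :
    affineCodim (X.1 ⊓ Y.1) = rank X + rank Y := by
  have h : (⨅ j, (![X, Y] j).1) = X.1 ⊓ Y.1 := by
    apply le_antisymm
    · exact le_inf (iInf_le _ (0 : Fin 2)) (iInf_le _ (1 : Fin 2))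
    · refine le_iInf fun j => ?_
      fin_cases j
      · exact inf_le_left
      · exact inf_le_right
  have := hD.rank_join ![X, Y] (by intro j; fin_cases j <;> assumption)
  rwa [h, Fin.sum_univ_two] at this

/-- Y contains Z, and both meet Y' in X. Additivity of rank (I3) then gives Y and Z equal
codimension. -/
theorem IsIdealDecomposition.eq_of_principal_left
    (hD : IsIdealDecomposition ![I, J]) [FiniteDimensional F V]
    {X Y Y' Z : 𝒜.IntersectionPoset}
    (hZ : I ∩ Set.Iic X = Set.Iic Z) (hY : Y ∈ I) (hY' : Y' ∈ J) (h : Y.1 ⊓ Y'.1 = X.1) :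
    Y = Z := by
  have hZI : Z ∈ I ∩ Set.Iic X := by rw [hZ]; exact le_rfl (a := Z)
  have hYZ : Y ∈ Set.Iic Z := by
    rw [← hZ]; exact ⟨hY, (h ▸ inf_le_left : X.1 ≤ Y.1)⟩
  have hXZ : X.1 ≤ Z.1 := hZI.2
  have hZY : Z.1 ≤ Y.1 := hYZ
  have hX : Z.1 ⊓ Y'.1 = X.1 :=
    le_antisymm (h ▸ inf_le_inf_right _ hZY) (le_inf hXZ (h ▸ inf_le_right))
  have h1 := hD.codim_inf hY hY'
  have h2 := hD.codim_inf hZI.1 hY'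
  rw [h] at h1
  rw [hX] at h2
  refine Subtype.ext (eq_of_le_of_affineCodim_le hZY Z.2.1 ?_).symm
  unfold rank at h1 h2
  omega

theorem IsIdealDecomposition.eq_of_principal_right
    (hD : IsIdealDecomposition ![I, J]) [FiniteDimensional F V]
    {X Y Y' Z : 𝒜.IntersectionPoset}
    (hZ : J ∩ Set.Iic X = Set.Iic Z) (hY : Y ∈ I) (hY' : Y' ∈ J) (h : Y.1 ⊓ Y'.1 = X.1) :
    Y' = Z := by
  have hZI : Z ∈ J ∩ Set.Iic X := by rw [hZ]; exact le_rfl (a := Z)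
  have hYZ : Y' ∈ Set.Iic Z := by
    rw [← hZ]; exact ⟨hY', (h ▸ inf_le_right : X.1 ≤ Y'.1)⟩
  have hXZ : X.1 ≤ Z.1 := hZI.2
  have hZY : Z.1 ≤ Y'.1 := hYZ
  have hX : Y.1 ⊓ Z.1 = X.1 :=
    le_antisymm (h ▸ inf_le_inf_left _ hZY) (le_inf (h ▸ inf_le_left) hXZ)
  have h1 := hD.codim_inf hY hY'
  have h2 := hD.codim_inf hY hZI.1
  rw [h] at h1
  rw [hX] at h2
  refine Subtype.ext (eq_of_le_of_affineCodim_le hZY Z.2.1 ?_).symm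
  unfold rank at h1 h2
  omega

end Decomposition

/-! ### Surjectivity: every monomial is a combination of products. -/

section Generation

variable {F V : Type*} [Field F] [AddCommGroup V] [Module F V]
variable {𝒜 : HyperplaneArrangement F V} (K : Type*) [CommRing K]

/-- The tuple `S` has its intersection in `I`. -/
def InterMem (I : Set 𝒜.IntersectionPoset) (S : List 𝒜.hyperplanes) : Prop :=
  ∃ Y ∈ I, Y.1 = inter S

theorem InterMem.nonempty {I : Set 𝒜.IntersectionPoset} {S : List 𝒜.hyperplanes}
    (h : InterMem I S) : (inter S : Set V).Nonempty := by
  obtain ⟨Y, -, hY⟩ := h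
  exact hY ▸ Y.2.1

theorem InterMem.eraseIdx {I : Set 𝒜.IntersectionPoset} (hI : IsLowerSet I)
    {S : List 𝒜.hyperplanes} (h : InterMem I S) (k : ℕ) : InterMem I (S.eraseIdx k) := by
  obtain ⟨W, hW⟩ := exists_poset_inter (S.eraseIdx k) (h.nonempty.mono (inter_eraseIdx_le S k))
  obtain ⟨Y, hYI, hY⟩ := h
  refine ⟨W, hI ?_ hYI, hW⟩
  change Y.1 ≤ W.1
  rw [hY, hW]
  exact inter_eraseIdx_le S k

/-- Products `e_S e_T` of total degree `n` with `∩ S ∈ I` and `∩ T ∈ J` both containing `X`. -/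
def productSet (I J : Set 𝒜.IntersectionPoset) (X : AffineSubspace F V) (n : ℕ) :
    Set (𝒜.OSAlgebra K) :=
  {x | ∃ S T : List 𝒜.hyperplanes, InterMem I S ∧ InterMem J T ∧ X ≤ inter S ∧ X ≤ inter T ∧
    S.length + T.length = n ∧ x = osE K S * osE K T}

theorem osE_mem_span_productSet [FiniteDimensional F V] {I J : Set 𝒜.IntersectionPoset}
    (hD : IsIdealDecomposition ![I, J])
    (S : List 𝒜.hyperplanes) (hS : (inter S : Set V).Nonempty) :
    osE K S ∈ Submodule.span K (productSet K I J (inter S) S.length) := by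
  induction hn : S.length generalizing S with
  | zero =>
    obtain rfl := List.eq_nil_of_length_eq_zero hn
    exact Submodule.subset_span ⟨[], [], ⟨⊥, hD.bot_mem_left, rfl⟩, ⟨⊥, hD.bot_mem_right, rfl⟩,
      le_rfl, le_rfl, rfl, by simp⟩
  | succ n ih =>
    obtain ⟨X, hX⟩ := exists_poset_inter S hS
    -- A nonempty tuple has its intersection inside a hyperplane, which has codimension 1.
    have hX0 : X ≠ ⊥ := by
      rintro rfl
      obtain ⟨H, S, rfl⟩ := List.exists_cons_of_length_eq_add_one hn
      have h1 : inter (H :: S) ≤ H.1 := inf_le_left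
      rw [← hX] at h1
      have h2 := affineCodim_anti h1
      rw [𝒜.codim_eq_one _ H.2] at h2
      exact absurd (h2.trans_eq affineCodim_top) (by simp)
    -- Expanding e_S = e_H ∂e_S and applying the induction hypothesis to each shortened tuple leaves
    -- only the products e_H e_S' e_T'.
    have key : ∀ H : 𝒜.hyperplanes, inter S ≤ H.1 →
        (∀ S' T', InterMem I S' → InterMem J T' → inter S ≤ inter S' → inter S ≤ inter T' →
          S'.length + T'.length = n → osE K [H] * (osE K S' * osE K T') ∈
            Submodule.span K (productSet K I J (inter S) (n + 1))) →
        osE K S ∈ Submodule.span K (productSet K I J (inter S) (n + 1)) := by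
      intro H hH h
      rw [osE, osProj_e_eq K S hS H hH, osProj_boundary_e, Finset.mul_sum]
      refine sum_mem fun k hk => ?_
      rw [mul_smul_comm]
      refine Submodule.smul_mem _ _ ?_
      have hk' := Finset.mem_range.1 hk
      have := ih (S.eraseIdx k) (hS.mono (inter_eraseIdx_le S k))
        (by rw [List.length_eraseIdx_of_lt hk']; omega)
      have h2 := Submodule.mem_map_of_mem (f := LinearMap.mulLeft K (osE K [H])) this
      rw [Submodule.map_span] at h2
      refine Submodule.span_le.2 ?_ h2
      rintro _ ⟨_, ⟨S', T', hS', hT', hl, hl', hlen, rfl⟩, rfl⟩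
      exact h S' T' hS' hT' ((inter_eraseIdx_le S k).trans hl)
        ((inter_eraseIdx_le S k).trans hl') hlen
    obtain ⟨Z, hZ0, hZ⟩ | ⟨Z, hZ0, hZ⟩ := hD.principal hX0
    all_goals
      obtain ⟨H, hH⟩ := exists_hyperplane_of_ne_bot hZ0
      have hZX : Z ∈ Set.Iic Z := le_rfl (a := Z)
      rw [← hZ] at hZX
      have hSH : inter S ≤ H.1 := hX ▸ (show X.1 ≤ Z.1 from hZX.2).trans hH
      refine key H hSH fun S' T' hS' hT' hl hl' hlen => ?_
    · obtain ⟨Y, hYI, hY⟩ := hS'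
      obtain ⟨W, hWI, hW⟩ := exists_mem_inf hZ hH hYI (by rw [hX, hY]; exact hl)
      refine Submodule.subset_span ⟨H :: S', T', ⟨W, hWI, by rw [hW, hY, inter_cons]⟩, hT',
        le_inf hSH hl, hl', by rw [List.length_cons]; omega, ?_⟩
      rw [osE_cons K H S', mul_assoc]
    · obtain ⟨Y, hYI, hY⟩ := hT'
      obtain ⟨W, hWI, hW⟩ := exists_mem_inf hZ hH hYI (by rw [hX, hY]; exact hl')
      -- Here H is absorbed on the J side, so e_H must first move past e_S', at the cost of a sign.
      rw [← mul_assoc, osE_mul_osE_singleton, smul_mul_assoc, mul_assoc, ← osE_cons K H T']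
      exact Submodule.smul_mem _ _ (Submodule.subset_span ⟨S', H :: T', hS',
        ⟨W, hWI, by rw [hW, hY, inter_cons]⟩,
        hl, le_inf hSH hl', by rw [List.length_cons]; omega, rfl⟩)

end Generation

end HyperplaneArrangement

/-! ### Separating components by projections. -/

section Projections

variable {R A B ι : Type*} [CommRing R] [AddCommGroup A] [Module R A] [AddCommGroup B] [Module R B]

theorem iSupIndep_of_projections (T : ι → Submodule R A) (p : ι → A →ₗ[R] A)
    (h1 : ∀ i, ∀ x ∈ T i, p i x = x) (h2 : ∀ i j, i ≠ j → ∀ x ∈ T i, p j x = 0) :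
    iSupIndep T := by
  intro i
  rw [Submodule.disjoint_def]
  intro x hx hx'
  have : (⨆ j, ⨆ (_ : j ≠ i), T j) ≤ LinearMap.ker (p i) :=
    iSup₂_le fun j hj x hx => h2 j i hj x hx
  rw [← h1 i x hx]
  exact this hx'

/-- The projections live on the target: p i isolates the image of the i-th summand, so injectivity
on each T i gives injectivity on their sum, with no projections on B. -/
theorem eq_zero_of_mem_iSup_of_projections (T : ι → Submodule R B) (f : B →ₗ[R] A)
    (p : ι → A →ₗ[R] A)
    (h1 : ∀ i, ∀ t ∈ T i, p i (f t) = f t) (h2 : ∀ i j, i ≠ j → ∀ t ∈ T i, p j (f t) = 0)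
    (hinj : ∀ i, ∀ t ∈ T i, f t = 0 → t = 0) {t : B} (ht : t ∈ ⨆ i, T i) (h0 : f t = 0) :
    t = 0 := by
  obtain ⟨c, hc, rfl⟩ := (Submodule.mem_iSup_iff_exists_finsupp _ _).1 ht
  refine Finset.sum_eq_zero fun i hi => hinj i _ (hc i) ?_
  have h := congrArg (p i) h0
  rw [Finsupp.sum, map_sum, map_sum, map_zero, Finset.sum_eq_single i] at h
  · rw [← h1 i _ (hc i), h]
  · exact fun j _ hj => h2 j i hj _ (hc j)
  · exact fun h => absurd hi h

end Projections

/-! ### The signed boundary on a tensor square. -/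

section TensorBoundary

variable {R A : Type*} [CommRing R] [Ring A] [Algebra R A]

/-- The map `x ⊗ y ↦ ∂ x ⊗ y + ε • x ⊗ ∂ y` on the tensor square of an algebra. -/
noncomputable def tensorBoundary (d : A →ₗ[R] A) (ε : R) : A ⊗[R] A →ₗ[R] A ⊗[R] A :=
  TensorProduct.map d LinearMap.id + ε • TensorProduct.map LinearMap.id d

theorem tensorBoundary_tmul (d : A →ₗ[R] A) (ε : R) (x y : A) :
    tensorBoundary d ε (x ⊗ₜ[R] y) = d x ⊗ₜ[R] y + ε • (x ⊗ₜ[R] d y) := by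
  simp [tensorBoundary]

theorem mul'_tensorBoundary_tmul (d : A →ₗ[R] A) (ε : R) (x y : A) :
    LinearMap.mul' R A (tensorBoundary d ε (x ⊗ₜ[R] y)) = d x * y + ε • (x * d y) := by
  simp [tensorBoundary]

theorem map_mulLeft_tensorBoundary_tmul (d : A →ₗ[R] A) (ε : R) {h x : A} (y : A)
    (h1 : h * d x = x) (h2 : h * x = 0) :
    TensorProduct.map (LinearMap.mulLeft R h) LinearMap.id (tensorBoundary d ε (x ⊗ₜ[R] y)) =
      x ⊗ₜ[R] y := by
  simp [tensorBoundary, h1, h2]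

theorem map_id_mulLeft_tensorBoundary_tmul (d : A →ₗ[R] A) {ε : R} {h y : A} (x : A)
    (hε : ε * ε = 1) (h1 : h * d y = y) (h2 : h * y = 0) :
    (ε • TensorProduct.map LinearMap.id (LinearMap.mulLeft R h)) (tensorBoundary d ε (x ⊗ₜ[R] y)) =
      x ⊗ₜ[R] y := by
  simp [tensorBoundary, h1, h2, smul_smul, hε]

theorem tensorBoundary_tmul_mem (d : A →ₗ[R] A) (ε : R) (T : Submodule R (A ⊗[R] A)) {x y : A}
    {m n : ℕ} {u v : ℕ → A} {a b : ℕ → R}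
    (hx : d x = ∑ k ∈ Finset.range m, a k • u k) (hy : d y = ∑ k ∈ Finset.range n, b k • v k)
    (hu : ∀ k < m, u k ⊗ₜ[R] y ∈ T) (hv : ∀ k < n, x ⊗ₜ[R] v k ∈ T) :
    tensorBoundary d ε (x ⊗ₜ[R] y) ∈ T := by
  rw [tensorBoundary_tmul, hx, hy, TensorProduct.sum_tmul, TensorProduct.tmul_sum]
  refine add_mem (sum_mem fun k hk => ?_) (Submodule.smul_mem _ _ (sum_mem fun k hk => ?_))
  · rw [← TensorProduct.smul_tmul']
    exact Submodule.smul_mem _ _ (hu k (Finset.mem_range.1 hk))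
  · rw [TensorProduct.tmul_smul]
    exact Submodule.smul_mem _ _ (hv k (Finset.mem_range.1 hk))

/-- The base case of the injectivity induction. Vanishing of c • 1 in A is enough; c itself need not
be 0. -/
theorem eq_zero_of_mul'_smul_one_tmul_one (c : R)
    (h : LinearMap.mul' R A (c • ((1 : A) ⊗ₜ[R] (1 : A))) = 0) :
    c • ((1 : A) ⊗ₜ[R] (1 : A)) = 0 := by
  rw [map_smul, LinearMap.mul'_apply, mul_one] at h
  rw [TensorProduct.smul_tmul', h, TensorProduct.zero_tmul]

end TensorBoundary

namespace HyperplaneArrangement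

/-! ### Injectivity on tensors over a fixed flat. -/

section Tensor

variable {F V : Type*} [Field F] [AddCommGroup V] [Module F V]
variable {𝒜 : HyperplaneArrangement F V} (K : Type*) [CommRing K]

/-- The span of the tensors `e_S ⊗ e_T` with `∩ S ∈ I`, `∩ T ∈ J` and `∩ S ∩ T = X`. -/
noncomputable def tensorComponent (I J : Set 𝒜.IntersectionPoset) (X : AffineSubspace F V) :
    Submodule K (𝒜.OSAlgebra K ⊗[K] 𝒜.OSAlgebra K) :=
  Submodule.span K {t | ∃ S T : List 𝒜.hyperplanes, InterMem I S ∧ InterMem J T ∧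
    inter S ⊓ inter T = X ∧ t = osE K S ⊗ₜ osE K T}

theorem tmul_mem_tensorComponent {I J : Set 𝒜.IntersectionPoset} {S T : List 𝒜.hyperplanes}
    (hS : InterMem I S) (hT : InterMem J T) :
    osE K S ⊗ₜ osE K T ∈ tensorComponent K I J (inter S ⊓ inter T) :=
  Submodule.subset_span ⟨S, T, hS, hT, rfl, rfl⟩

theorem codim_inter_inf {I J : Set 𝒜.IntersectionPoset}
    (hD : IsIdealDecomposition ![I, J]) {S T : List 𝒜.hyperplanes}
    (hS : InterMem I S) (hT : InterMem J T) :
    affineCodim (inter S ⊓ inter T) = affineCodim (inter S) + affineCodim (inter T) := by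
  obtain ⟨Y, hY, hYS⟩ := hS
  obtain ⟨Y', hY', hYT⟩ := hT
  rw [← hYS, ← hYT]
  exact hD.codim_inf hY hY'

variable [FiniteDimensional F V] {I J : Set 𝒜.IntersectionPoset}

-- Generators with a singular tuple are 0 in the tensor product, so lengths may be taken equal to
-- codimensions.
@[elab_as_elim]
theorem tensorComponent_induction {X : AffineSubspace F V}
    {P : ∀ t : 𝒜.OSAlgebra K ⊗[K] 𝒜.OSAlgebra K, t ∈ tensorComponent K I J X → Prop}
    (gen : ∀ (S T : List 𝒜.hyperplanes) (hS : InterMem I S) (hT : InterMem J T)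
      (h : inter S ⊓ inter T = X),
      S.length = affineCodim (inter S) → T.length = affineCodim (inter T) →
      P (osE K S ⊗ₜ osE K T) (h ▸ tmul_mem_tensorComponent K hS hT))
    (zero : P 0 (zero_mem _))
    (add : ∀ s t hs ht, P s hs → P t ht → P (s + t) (add_mem hs ht))
    (smul : ∀ (r : K) t ht, P t ht → P (r • t) (Submodule.smul_mem _ r ht))
    {t : 𝒜.OSAlgebra K ⊗[K] 𝒜.OSAlgebra K} (ht : t ∈ tensorComponent K I J X) : P t ht := by
  induction ht using Submodule.span_induction with
  | mem t h =>
    obtain ⟨S, T, hS, hT, h, rfl⟩ := h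
    by_cases h1 : Singular S
    · have : osE K S ⊗ₜ[K] osE K T = 0 := by
        rw [osE, osProj_of_singular K h1, TensorProduct.zero_tmul]
      simpa only [this] using zero
    by_cases h2 : Singular T
    · have : osE K S ⊗ₜ[K] osE K T = 0 := by
        rw [osE, osE, osProj_of_singular K h2, TensorProduct.tmul_zero]
      simpa only [this] using zero
    exact gen S T hS hT h (length_eq_of_not_singular h1) (length_eq_of_not_singular h2)
  | zero => exact zero
  | add s t _ _ hs ht => exact add s t _ _ hs ht
  | smul r t _ ht => exact smul r t _ ht

theorem interProj_mul_of_mem {X : AffineSubspace F V}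
    {t : 𝒜.OSAlgebra K ⊗[K] 𝒜.OSAlgebra K} (ht : t ∈ tensorComponent K I J X) :
    interProj K X (LinearMap.mul' K _ t) = LinearMap.mul' K _ t := by
  induction ht using tensorComponent_induction with
  | gen S T hS hT h _ _ =>
    rw [LinearMap.mul'_apply, ← osE_append, interProj_osE, inter_append, if_pos h]
  | zero => simp
  | add s t _ _ hs ht => rw [map_add, map_add, hs, ht]
  | smul r t _ ht => rw [map_smul, map_smul, ht]

theorem interProj_mul_of_mem_of_ne {X Y : AffineSubspace F V} (hXY : X ≠ Y)
    {t : 𝒜.OSAlgebra K ⊗[K] 𝒜.OSAlgebra K} (ht : t ∈ tensorComponent K I J X) :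
    interProj K Y (LinearMap.mul' K _ t) = 0 := by
  induction ht using tensorComponent_induction with
  | gen S T hS hT h _ _ =>
    rw [LinearMap.mul'_apply, ← osE_append, interProj_osE, inter_append, h, if_neg hXY]
  | zero => simp
  | add s t _ _ hs ht => rw [map_add, map_add, hs, ht, add_zero]
  | smul r t _ ht => rw [map_smul, map_smul, ht, smul_zero]

theorem map_mulLeft_tensorBoundary {X : AffineSubspace F V} {H : 𝒜.hyperplanes}
    (hH : ∀ S T : List 𝒜.hyperplanes, InterMem I S → InterMem J T → inter S ⊓ inter T = X →
      inter S ≤ H.1) (ε : K)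
    {t : 𝒜.OSAlgebra K ⊗[K] 𝒜.OSAlgebra K} (ht : t ∈ tensorComponent K I J X) :
    TensorProduct.map (LinearMap.mulLeft K (osE K [H])) LinearMap.id
      (tensorBoundary (osBoundary K) ε t) = t := by
  induction ht using tensorComponent_induction with
  | gen S T hS hT h _ _ =>
    have hSH := hH S T hS hT h
    exact map_mulLeft_tensorBoundary_tmul _ _ _ (osE_eq_mul_osBoundary K hS.nonempty H hSH)
      (osE_singleton_mul_eq_zero K hS.nonempty H hSH)
  | zero => simp only [map_zero]
  | add s t _ _ hs ht => simp only [map_add, hs, ht]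
  | smul r t _ ht => simp only [map_smul, ht]

theorem map_id_mulLeft_tensorBoundary {X : AffineSubspace F V} {H : 𝒜.hyperplanes}
    (hH : ∀ S T : List 𝒜.hyperplanes, InterMem I S → InterMem J T → inter S ⊓ inter T = X →
      inter T ≤ H.1) {ε : K} (hε : ε * ε = 1)
    {t : 𝒜.OSAlgebra K ⊗[K] 𝒜.OSAlgebra K} (ht : t ∈ tensorComponent K I J X) :
    (ε • TensorProduct.map LinearMap.id (LinearMap.mulLeft K (osE K [H])))
      (tensorBoundary (osBoundary K) ε t) = t := by
  induction ht using tensorComponent_induction with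
  | gen S T hS hT h _ _ =>
    have hTH := hH S T hS hT h
    exact map_id_mulLeft_tensorBoundary_tmul _ _ hε (osE_eq_mul_osBoundary K hT.nonempty H hTH)
      (osE_singleton_mul_eq_zero K hT.nonempty H hTH)
  | zero => simp only [map_zero]
  | add s t _ _ hs ht => simp only [map_add, hs, ht]
  | smul r t _ ht => simp only [map_smul, ht]

/-- The Leibniz sign (-1)^|S| depends on the generator, but |S| is the codimension of ∩S, so one ε
serves the whole component. -/
theorem mul_tensorBoundary
    (hD : IsIdealDecomposition ![I, J]) {X : AffineSubspace F V} {ε : K}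
    (hε : ∀ S T : List 𝒜.hyperplanes, InterMem I S → InterMem J T → inter S ⊓ inter T = X →
      (-1 : K) ^ affineCodim (inter S) = ε)
    {t : 𝒜.OSAlgebra K ⊗[K] 𝒜.OSAlgebra K} (ht : t ∈ tensorComponent K I J X) :
    LinearMap.mul' K _ (tensorBoundary (osBoundary K) ε t) = osBoundary K (LinearMap.mul' K _ t) := by
  induction ht using tensorComponent_induction with
  | gen S T hS hT h hl _ =>
    have hne : (inter S ⊓ inter T : Set V).Nonempty := by
      obtain ⟨Y, hY, hYS⟩ := hS
      obtain ⟨Y', hY', hYT⟩ := hT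
      rw [← hYS, ← hYT]
      exact hD.nonempty_inf hY hY'
    have h2 : (-1 : K) ^ S.length = ε := by rw [hl, hε S T hS hT h]
    subst h2
    exact (mul'_tensorBoundary_tmul _ _ _ _).trans ((congrArg (osBoundary K)
      (LinearMap.mul'_apply)).trans (osBoundary_osE_mul_osE K hne)).symm
  | zero => simp
  | add s t _ _ hs ht => simp only [map_add, hs, ht]
  | smul r t _ ht => simp only [map_smul, ht]

/-- Dropping a member of an independent tuple lowers the codimension of its intersection, and by
(I3) that of the joint intersection. -/
theorem tensorBoundary_mem
    (hD : IsIdealDecomposition ![I, J]) {X : AffineSubspace F V} (ε : K)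
    {t : 𝒜.OSAlgebra K ⊗[K] 𝒜.OSAlgebra K} (ht : t ∈ tensorComponent K I J X) :
    tensorBoundary (osBoundary K) ε t ∈
      ⨆ Y : {Y : AffineSubspace F V // affineCodim Y < affineCodim X},
        tensorComponent K I J Y.1 := by
  induction ht using tensorComponent_induction with
  | gen S T hS hT h hl hl' =>
    have hmem : ∀ S' T', InterMem I S' → InterMem J T' →
        affineCodim (inter S') + affineCodim (inter T') < affineCodim X →
        osE K S' ⊗ₜ[K] osE K T' ∈
          ⨆ Y : {Y : AffineSubspace F V // affineCodim Y < affineCodim X},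
            tensorComponent K I J Y.1 := fun S' T' hS' hT' hlt =>
      Submodule.mem_iSup_of_mem
        (⟨inter S' ⊓ inter T', by rwa [codim_inter_inf hD hS' hT']⟩ :
          {Y : AffineSubspace F V // affineCodim Y < affineCodim X})
        (tmul_mem_tensorComponent K hS' hT')
    have hX := codim_inter_inf hD hS hT
    rw [h] at hX
    refine tensorBoundary_tmul_mem _ _ _
      ((osBoundary_osE K hS.nonempty).trans (osProj_boundary_e K S))
      ((osBoundary_osE K hT.nonempty).trans (osProj_boundary_e K T))
      (fun k hk => ?_) (fun k hk => ?_)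
    · have hS' := hS.eraseIdx (hD.ideal 0).2 k
      refine hmem _ _ hS' hT ?_
      have := affineCodim_inter_le _ hS'.nonempty
      rw [List.length_eraseIdx_of_lt hk] at this
      omega
    · have hT' := hT.eraseIdx (hD.ideal 1).2 k
      refine hmem _ _ hS hT' ?_
      have := affineCodim_inter_le _ hT'.nonempty
      rw [List.length_eraseIdx_of_lt hk] at this
      omega
  | zero => simp
  | add s t _ _ hs ht => rw [map_add]; exact add_mem hs ht
  | smul r t _ ht => rw [map_smul]; exact Submodule.smul_mem _ _ ht

/-- The tensor boundary lies over flats of smaller codimension and its product is ∂0 = 0;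
injectivity there, flat by flat, kills it. -/
theorem tensorBoundary_eq_zero
    (hD : IsIdealDecomposition ![I, J]) {X : AffineSubspace F V} {ε : K}
    (hε : ∀ S T : List 𝒜.hyperplanes, InterMem I S → InterMem J T → inter S ⊓ inter T = X →
      (-1 : K) ^ affineCodim (inter S) = ε)
    (hinj : ∀ Y : AffineSubspace F V, affineCodim Y < affineCodim X →
      ∀ t ∈ tensorComponent K I J Y, LinearMap.mul' K (𝒜.OSAlgebra K) t = 0 → t = 0)
    {t : 𝒜.OSAlgebra K ⊗[K] 𝒜.OSAlgebra K} (ht : t ∈ tensorComponent K I J X)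
    (h0 : LinearMap.mul' K _ t = 0) : tensorBoundary (osBoundary K) ε t = 0 := by
  have h := tensorBoundary_mem K hD ε ht
  refine eq_zero_of_mem_iSup_of_projections _ (LinearMap.mul' K (𝒜.OSAlgebra K))
    (fun Y : {Y : AffineSubspace F V // affineCodim Y < affineCodim X} => interProj K Y.1)
    ?_ ?_ (fun Y t ht h => hinj Y.1 Y.2 t ht h) h ?_
  · exact fun Y t ht => interProj_mul_of_mem K ht
  · exact fun Y Y' h t ht => interProj_mul_of_mem_of_ne K (fun h' => h (Subtype.ext h')) ht
  · rw [mul_tensorBoundary K hD hε ht, h0, map_zero]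

theorem eq_zero_of_mem_tensorComponent
    (hD : IsIdealDecomposition ![I, J]) (X : AffineSubspace F V)
    {t : 𝒜.OSAlgebra K ⊗[K] 𝒜.OSAlgebra K} (ht : t ∈ tensorComponent K I J X)
    (h0 : LinearMap.mul' K _ t = 0) : t = 0 := by
  induction hn : affineCodim X using Nat.strong_induction_on generalizing X t with
  | _ n ih =>
  -- X is an arbitrary affine subspace so far. Without generators the component is zero; with one,
  -- (I2) makes X an element of the poset.
  by_cases hgen : ∃ S T : List 𝒜.hyperplanes, InterMem I S ∧ InterMem J T ∧
      inter S ⊓ inter T = X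
  swap
  · clear h0
    induction ht using tensorComponent_induction with
    | gen S T hS hT h _ _ => exact absurd ⟨S, T, hS, hT, h⟩ hgen
    | zero => rfl
    | add s t _ _ hs ht => rw [hs, ht, add_zero]
    | smul r t _ ht => rw [ht, smul_zero]
  obtain ⟨X, rfl⟩ : ∃ X' : 𝒜.IntersectionPoset, X'.1 = X := by
    obtain ⟨S, T, ⟨Y, hY, hYS⟩, ⟨Y', hY', hYT⟩, rfl⟩ := hgen
    rw [← inter_append]
    apply exists_poset_inter
    rw [inter_append, ← hYS, ← hYT]
    exact hD.nonempty_inf hY hY'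
  have hcycle := fun ε hε => tensorBoundary_eq_zero K hD (ε := ε) hε
    (fun Y hY t ht h => ih _ (hn ▸ hY) Y ht h rfl) ht h0
  by_cases hX : X = ⊥
  · subst hX
    -- Over V the nonsingular tuples have length 0, so only 1 ⊗ 1 generates.
    obtain ⟨c, rfl⟩ : ∃ c : K, t = c • (1 ⊗ₜ 1) := by
      clear h0 hcycle
      induction ht using tensorComponent_induction with
      | gen S T hS hT h hl hl' =>
        have h' : inter S ⊓ inter T = ⊤ := h
        rw [inf_eq_top_iff] at h'
        rw [h'.1, affineCodim_top] at hl
        rw [h'.2, affineCodim_top] at hl'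
        rw [List.eq_nil_of_length_eq_zero hl, List.eq_nil_of_length_eq_zero hl']
        exact ⟨1, by simp⟩
      | zero => exact ⟨0, by simp⟩
      | add s t _ _ hs ht =>
        obtain ⟨c, rfl⟩ := hs
        obtain ⟨d, rfl⟩ := ht
        exact ⟨c + d, (add_smul _ _ _).symm⟩
      | smul r t _ ht =>
        obtain ⟨c, rfl⟩ := ht
        exact ⟨r * c, (mul_smul _ _ _).symm⟩
    exact eq_zero_of_mul'_smul_one_tmul_one c h0
  obtain ⟨Z, hZ0, hZ⟩ | ⟨Z, hZ0, hZ⟩ := hD.principal hX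
  · obtain ⟨H, hH⟩ := exists_hyperplane_of_ne_bot hZ0
    -- The first factor always has intersection Z: the sign is constant, and e_H undoes ∂ on that
    -- factor for every generator.
    have hSZ : ∀ S T : List 𝒜.hyperplanes, InterMem I S → InterMem J T →
        inter S ⊓ inter T = X.1 → inter S = Z.1 := by
      rintro S T ⟨Y, hY, hYS⟩ ⟨Y', hY', hYT⟩ h
      rw [← hYS, ← hYT] at h
      rw [← hYS, hD.eq_of_principal_left hZ hY hY' h]
    have hb := hcycle _ (fun S T hS hT h => by rw [hSZ S T hS hT h])
    have h := map_mulLeft_tensorBoundary K (H := H)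
      (fun S T hS hT h => (hSZ S T hS hT h).trans_le hH) ((-1 : K) ^ affineCodim Z.1) ht
    exact h.symm.trans ((congrArg _ hb).trans (map_zero _))
  · obtain ⟨H, hH⟩ := exists_hyperplane_of_ne_bot hZ0
    have hTZ : ∀ S T : List 𝒜.hyperplanes, InterMem I S → InterMem J T →
        inter S ⊓ inter T = X.1 → inter T = Z.1 := by
      rintro S T ⟨Y, hY, hYS⟩ ⟨Y', hY', hYT⟩ h
      rw [← hYS, ← hYT] at h
      rw [← hYT, hD.eq_of_principal_right hZ hY hY' h]
    -- Now the second factor is pinned to Z, and rank additivity fixes the codimension of the first.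
    have hb := hcycle ((-1 : K) ^ (affineCodim X.1 - affineCodim Z.1))
      (fun S T hS hT h => by
        have h1 := codim_inter_inf hD hS hT
        rw [h, hTZ S T hS hT h] at h1
        rw [h1, Nat.add_sub_cancel])
    have hε : (-1 : K) ^ (affineCodim X.1 - affineCodim Z.1) *
        (-1 : K) ^ (affineCodim X.1 - affineCodim Z.1) = 1 := by
      rw [← mul_pow, neg_one_mul, neg_neg, one_pow]
    have h := map_id_mulLeft_tensorBoundary K (H := H)
      (fun S T hS hT h => (hTZ S T hS hT h).trans_le hH) hε ht
    exact h.symm.trans ((congrArg _ hb).trans (map_zero _))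

end Tensor

end HyperplaneArrangement

/-! ### Split injections, tensor products and transport of gradings. -/

section Retraction

variable {R A B C D ι : Type*} [CommRing R] [AddCommMonoid A] [Module R A] [AddCommMonoid B]
  [Module R B] [AddCommMonoid C] [Module R C] [AddCommMonoid D] [Module R D]

theorem exists_leftInverse_coeLinearMap [Finite ι] [DecidableEq ι] (T : ι → Submodule R A)
    (p : ι → A →ₗ[R] A) (hp : ∀ i x, p i x ∈ T i)
    (h1 : ∀ i, ∀ x ∈ T i, p i x = x) (h2 : ∀ i j, i ≠ j → ∀ x ∈ T i, p j x = 0) :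
    ∃ r : A →ₗ[R] ⨁ i, T i, r ∘ₗ DirectSum.coeLinearMap T = LinearMap.id := by
  cases nonempty_fintype ι
  refine ⟨∑ i, DirectSum.lof R ι (fun i => T i) i ∘ₗ (p i).codRestrict (T i) (hp i), ?_⟩
  refine DirectSum.linearMap_ext R fun i => LinearMap.ext fun x => ?_
  simp only [LinearMap.comp_apply, DirectSum.coeLinearMap_lof, LinearMap.sum_apply,
    LinearMap.id_apply]
  rw [Finset.sum_eq_single i]
  · congr 1
    exact Subtype.ext (h1 i x x.2)
  · intro j _ hj
    have : (p j).codRestrict (T j) (hp j) x = 0 := Subtype.ext (h2 i j hj.symm x x.2)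
    rw [this, map_zero]
  · simp

/-- Over a general ring tensoring need not preserve injectivity; split injections are safe, hence
the retractions. -/
theorem TensorProduct.map_injective_of_leftInverse {f : A →ₗ[R] B} {g : C →ₗ[R] D}
    (hf : ∃ r : B →ₗ[R] A, r ∘ₗ f = LinearMap.id) (hg : ∃ s : D →ₗ[R] C, s ∘ₗ g = LinearMap.id) :
    Function.Injective (TensorProduct.map f g) := by
  obtain ⟨r, hr⟩ := hf
  obtain ⟨s, hs⟩ := hg
  have h : TensorProduct.map r s ∘ₗ TensorProduct.map f g = LinearMap.id := by
    rw [← TensorProduct.map_comp, hr, hs, TensorProduct.map_id]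
  exact Function.LeftInverse.injective (g := TensorProduct.map r s) (LinearMap.congr_fun h)

theorem TensorProduct.map_mem_span {f : A →ₗ[R] B} {g : C →ₗ[R] D} {s : Set B} {t : Set D}
    (hf : ∀ x, f x ∈ Submodule.span R s) (hg : ∀ y, g y ∈ Submodule.span R t) (z : A ⊗[R] C) :
    TensorProduct.map f g z ∈
      Submodule.span R (Set.image2 (fun x y => x ⊗ₜ[R] y) s t) := by
  induction z with
  | zero => simp
  | add x y hx hy => rw [map_add]; exact add_mem hx hy
  | tmul x y =>
    rw [TensorProduct.map_tmul]
    have := Submodule.apply_mem_map₂ (TensorProduct.mk R B D) (hf x) (hg y)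
    rwa [Submodule.map₂_span_span] at this

theorem TensorProduct.range_map_subtype_le {P : Submodule R A} {Q : Submodule R C}
    {f : A ⊗[R] C →ₗ[R] B} {N : Submodule R B} (h : ∀ x ∈ P, ∀ y ∈ Q, f (x ⊗ₜ y) ∈ N) :
    LinearMap.range (TensorProduct.map P.subtype Q.subtype) ≤ N.comap f := by
  rintro _ ⟨z, rfl⟩
  rw [Submodule.mem_comap]
  induction z with
  | zero => simp
  | add x y hx hy => rw [map_add, map_add]; exact add_mem hx hy
  | tmul x y => exact h x x.2 y y.2

theorem TensorProduct.tmul_mem_range_map_subtype {P : Submodule R A} {Q : Submodule R C}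
    {x : A} {y : C} (hx : x ∈ P) (hy : y ∈ Q) :
    x ⊗ₜ[R] y ∈ LinearMap.range (TensorProduct.map P.subtype Q.subtype) :=
  ⟨(⟨x, hx⟩ : P) ⊗ₜ (⟨y, hy⟩ : Q), rfl⟩

theorem DirectSum.IsInternal.of_map_eq [DecidableEq ι] {f : A →ₗ[R] B}
    (hf : Function.Bijective f) {S : ι → Submodule R A} {T : ι → Submodule R B}
    (h : ∀ i, (S i).map f = T i) (hT : DirectSum.IsInternal T) : DirectSum.IsInternal S := by
  have hfS : ∀ i, ∀ x ∈ S i, f x ∈ T i := fun i x hx => h i ▸ Submodule.mem_map_of_mem hx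
  let φ : ∀ i, S i →+ T i := fun i => (f.restrict (hfS i)).toAddMonoidHom
  have hφ : ∀ i, Function.Bijective (φ i) := fun i => by
    constructor
    · exact fun x y hxy => Subtype.ext (hf.1 (Subtype.ext_iff.1 hxy))
    · rintro ⟨y, hy⟩
      rw [← h i] at hy
      obtain ⟨x, hx, rfl⟩ := hy
      exact ⟨⟨x, hx⟩, rfl⟩
  have hmap : Function.Bijective (DirectSum.map φ) :=
    ⟨(DirectSum.map_injective φ).2 fun i => (hφ i).1,
      (DirectSum.map_surjective φ).2 fun i => (hφ i).2⟩
  have hcomp : f.toAddMonoidHom.comp (DirectSum.coeAddMonoidHom S) =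
      (DirectSum.coeAddMonoidHom T).comp (DirectSum.map φ) := by
    refine DirectSum.addHom_ext fun i x => ?_
    simp [φ]
  refine (Function.Bijective.of_comp_iff' hf _).1 ?_
  have := congrArg DFunLike.coe hcomp
  rw [AddMonoidHom.coe_comp, AddMonoidHom.coe_comp] at this
  change Function.Bijective (f.toAddMonoidHom ∘ DirectSum.coeAddMonoidHom S)
  rw [this]
  exact hT.comp hmap

theorem injective_mul'_comp_map {A : Type*} [Ring A] [Algebra R A]
    {f : B →ₗ[R] A} {g : C →ₗ[R] A} (hf : ∃ r : A →ₗ[R] B, r ∘ₗ f = LinearMap.id)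
    (hg : ∃ s : A →ₗ[R] C, s ∘ₗ g = LinearMap.id) (T : ι → Submodule R (A ⊗[R] A))
    (p : ι → A →ₗ[R] A) (hT : ∀ z, TensorProduct.map f g z ∈ ⨆ i, T i)
    (h1 : ∀ i, ∀ t ∈ T i, p i (LinearMap.mul' R A t) = LinearMap.mul' R A t)
    (h2 : ∀ i j, i ≠ j → ∀ t ∈ T i, p j (LinearMap.mul' R A t) = 0)
    (hinj : ∀ i, ∀ t ∈ T i, LinearMap.mul' R A t = 0 → t = 0) :
    Function.Injective (LinearMap.mul' R A ∘ₗ TensorProduct.map f g) := by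
  intro z z' hz
  rw [LinearMap.comp_apply, LinearMap.comp_apply, ← sub_eq_zero, ← map_sub] at hz
  apply TensorProduct.map_injective_of_leftInverse hf hg
  rw [← sub_eq_zero]
  exact eq_zero_of_mem_iSup_of_projections T (LinearMap.mul' R A) p h1 h2 hinj
    (sub_mem (hT z) (hT z')) hz

end Retraction

namespace HyperplaneArrangement

/-! ### Degrees and the bijectivity of κ. -/

section Main

variable {F V : Type*} [Field F] [AddCommGroup V] [Module F V]
variable {𝒜 : HyperplaneArrangement F V} (K : Type*) [CommRing K]

variable (𝒜) in
theorem exteriorPower_eq_span (p : ℕ) :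
    (⋀[K]^p (𝒜.hyperplanes →₀ K)) =
      Submodule.span K {x | ∃ S : List 𝒜.hyperplanes, S.length = p ∧ x = e K S} := by
  induction p with
  | zero =>
    rw [ExteriorAlgebra.exteriorPower, pow_zero, Submodule.one_eq_span_one_set]
    congr 1
    ext x
    simp [List.length_eq_zero_iff]
  | succ p ih =>
    have h : LinearMap.range (ExteriorAlgebra.ι K (M := 𝒜.hyperplanes →₀ K)) =
        Submodule.span K (Set.range fun H : 𝒜.hyperplanes => e K [H]) := by
      rw [LinearMap.range_eq_map, ← (Finsupp.basisSingleOne (R := K)).span_eq,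
        Submodule.map_span, ← Set.range_comp]
      simp only [Function.comp_def, e_singleton, Finsupp.coe_basisSingleOne]
    rw [ExteriorAlgebra.exteriorPower, pow_succ', ← ExteriorAlgebra.exteriorPower, ih, h,
      Submodule.span_mul_span]
    congr 1
    ext x
    constructor
    · rintro ⟨_, ⟨H, rfl⟩, _, ⟨S, rfl, rfl⟩, rfl⟩
      exact ⟨H :: S, rfl, (e_cons K H S).symm⟩
    · rintro ⟨S, hS, rfl⟩
      obtain ⟨H, S, rfl⟩ := List.exists_cons_of_length_eq_add_one hS
      exact ⟨_, ⟨H, rfl⟩, _, ⟨S, by simpa using hS, rfl⟩, (e_cons K H S).symm⟩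

variable (𝒜) in
theorem osDegree_eq_span (p : ℕ) :
    osDegree 𝒜 K p =
      Submodule.span K {x | ∃ S : List 𝒜.hyperplanes, S.length = p ∧ x = osE K S} := by
  rw [osDegree, exteriorPower_eq_span, Submodule.map_span]
  congr 1
  ext x
  constructor
  · rintro ⟨_, ⟨S, hS, rfl⟩, rfl⟩; exact ⟨S, hS, rfl⟩
  · rintro ⟨S, hS, rfl⟩; exact ⟨_, ⟨S, hS, rfl⟩, rfl⟩

theorem osE_mem_osDegree (S : List 𝒜.hyperplanes) : osE K S ∈ osDegree 𝒜 K S.length := by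
  rw [osDegree_eq_span]
  exact Submodule.subset_span ⟨S, rfl, rfl⟩

theorem mul_mem_osDegree {i j : ℕ} {x y : 𝒜.OSAlgebra K} (hx : x ∈ osDegree 𝒜 K i)
    (hy : y ∈ osDegree 𝒜 K j) : x * y ∈ osDegree 𝒜 K (i + j) := by
  have := Submodule.mul_mem_mul hx hy
  rw [osDegree_eq_span, osDegree_eq_span, Submodule.span_mul_span] at this
  rw [osDegree_eq_span]
  refine Submodule.span_mono ?_ this
  rintro _ ⟨_, ⟨S, rfl, rfl⟩, _, ⟨T, rfl, rfl⟩, rfl⟩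
  exact ⟨S ++ T, List.length_append, (osE_append K S T).symm⟩

theorem osSumMap_lof (I : Set 𝒜.IntersectionPoset) [DecidableEq I] (X : I)
    (x : osComponent K X.1) :
    osSumMap K I (DirectSum.lof K I (fun X => osComponent K X.1) X x) = x := by
  classical
  unfold osSumMap
  convert DirectSum.coeLinearMap_lof (fun X : I => osComponent K X.1) X x

theorem osSumMap_mem_span (I : Set 𝒜.IntersectionPoset) (x : OSSum K I) :
    osSumMap K I x ∈ Submodule.span K {x | ∃ S : List 𝒜.hyperplanes, InterMem I S ∧
      x = osE K S} := by
  classical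
  induction x using DirectSum.induction_on with
  | zero => simp
  | add x y hx hy => rw [map_add]; exact add_mem hx hy
  | of X x =>
    have h : (x : 𝒜.OSAlgebra K) ∈ _ := (osComponent_eq_span K X.1).le x.2
    have h2 := osSumMap_lof K I X x
    rw [DirectSum.lof_eq_of] at h2
    rw [h2]
    refine Submodule.span_mono ?_ h
    rintro _ ⟨S, hS, rfl⟩
    exact ⟨S, ⟨X.1, X.2, hS.symm⟩, rfl⟩

theorem osSumMap_mem_osDegree {I : Set 𝒜.IntersectionPoset} {p : ℕ} {x : OSSum K I}
    (hx : x ∈ osSumDegree K I p) : osSumMap K I x ∈ osDegree 𝒜 K p := by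
  classical
  have h : ∀ X : I, (x X : 𝒜.OSAlgebra K) ∈ osDegree 𝒜 K p := fun X => by
    have := (Submodule.mem_iInf _).1 hx X
    exact this
  have hs : osSumMap K I x = DirectSum.coeLinearMap (fun X : I => osComponent K X.1) x := by
    unfold osSumMap
    convert rfl
  rw [hs, DirectSum.coeLinearMap_eq_dfinsuppSum]
  exact sum_mem fun X _ => h X

theorem exists_osSumMap_eq {I : Set 𝒜.IntersectionPoset} {S : List 𝒜.hyperplanes}
    (hS : InterMem I S) : ∃ x ∈ osSumDegree K I S.length, osSumMap K I x = osE K S := by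
  classical
  obtain ⟨Y, hY, hYS⟩ := hS
  refine ⟨DirectSum.lof K I (fun X => osComponent K X.1) ⟨Y, hY⟩
    ⟨osE K S, osE_mem_osComponent K hYS.symm⟩, ?_, osSumMap_lof K I _ _⟩
  refine (Submodule.mem_iInf _).2 fun X => ?_
  change ((DirectSum.lof K I (fun X => osComponent K X.1) ⟨Y, hY⟩
    ⟨osE K S, osE_mem_osComponent K hYS.symm⟩ : OSSum K I) X : 𝒜.OSAlgebra K) ∈
    osDegree 𝒜 K S.length
  by_cases hX : (⟨Y, hY⟩ : I) = X
  · subst hX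
    rw [DirectSum.lof_apply]
    exact osE_mem_osDegree K S
  · rw [DirectSum.lof_eq_of, DirectSum.of_eq_of_ne _ _ _ (Ne.symm hX)]
    exact zero_mem _

theorem kappa_eq (I J : Set 𝒜.IntersectionPoset) :
    kappa K I J = LinearMap.mul' K (𝒜.OSAlgebra K) ∘ₗ
      TensorProduct.map (osSumMap K I) (osSumMap K J) :=
  TensorProduct.ext' fun _ _ => rfl

theorem kappa_tmul (I J : Set 𝒜.IntersectionPoset) (x : OSSum K I) (y : OSSum K J) :
    kappa K I J (x ⊗ₜ y) = osSumMap K I x * osSumMap K J y := rfl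

theorem range_map_subtype_le_comap_kappa (I J : Set 𝒜.IntersectionPoset) (i j : ℕ) :
    LinearMap.range (TensorProduct.map (osSumDegree K I i).subtype (osSumDegree K J j).subtype) ≤
      (osDegree 𝒜 K (i + j)).comap (kappa K I J) :=
  TensorProduct.range_map_subtype_le (P := osSumDegree K I i) (Q := osSumDegree K J j)
    (f := kappa K I J) (N := osDegree 𝒜 K (i + j)) fun x hx y hy =>
    (kappa_tmul K I J x y).symm ▸
      mul_mem_osDegree K (osSumMap_mem_osDegree K hx) (osSumMap_mem_osDegree K hy)

theorem tmul_mem_osTensorDegree {I J : Set 𝒜.IntersectionPoset} {i j p : ℕ} {x : OSSum K I}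
    {y : OSSum K J} (hx : x ∈ osSumDegree K I i) (hy : y ∈ osSumDegree K J j) (h : i + j = p) :
    x ⊗ₜ[K] y ∈ osTensorDegree K I J p := by
  have hle : LinearMap.range (TensorProduct.map (osSumDegree K I i).subtype
      (osSumDegree K J j).subtype) ≤ osTensorDegree K I J p :=
    le_iSup_of_le i (le_iSup_of_le j (le_iSup_of_le h le_rfl))
  exact hle (TensorProduct.tmul_mem_range_map_subtype hx hy)

variable [FiniteDimensional F V]

variable (𝒜) in
theorem isInternal_osDegree : DirectSum.IsInternal (osDegree 𝒜 K) := by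
  rw [DirectSum.isInternal_submodule_iff_iSupIndep_and_iSup_eq_top]
  constructor
  · refine iSupIndep_of_projections _ (degreeProj K) (fun p x hx => ?_) fun p q hpq x hx => ?_
    · rw [osDegree_eq_span] at hx
      refine LinearMap.eqOn_span (f := degreeProj K p) (g := LinearMap.id) ?_ hx
      rintro _ ⟨S, rfl, rfl⟩
      rw [degreeProj_osE, if_pos rfl, LinearMap.id_apply]
    · rw [osDegree_eq_span] at hx
      refine LinearMap.eqOn_span (f := degreeProj K q) (g := 0) ?_ hx
      rintro _ ⟨S, rfl, rfl⟩
      rw [degreeProj_osE, if_neg hpq, LinearMap.zero_apply]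
  · rw [eq_top_iff, ← span_range_osE, Submodule.span_le]
    rintro _ ⟨S, rfl⟩
    exact Submodule.mem_iSup_of_mem S.length (osE_mem_osDegree K S)

theorem interProj_mem (X : 𝒜.IntersectionPoset) (x : 𝒜.OSAlgebra K) :
    interProj K X.1 x ∈ osComponent K X := by
  have h : Submodule.span K (Set.range (osE K : List 𝒜.hyperplanes → 𝒜.OSAlgebra K)) ≤
      (osComponent K X).comap (interProj K X.1) := by
    rw [Submodule.span_le]
    rintro _ ⟨S, rfl⟩
    rw [SetLike.mem_coe, Submodule.mem_comap, interProj_osE]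
    split_ifs with h
    · exact osE_mem_osComponent K h
    · exact zero_mem _
  rw [span_range_osE] at h
  exact h trivial

/-- The projections `interProj` separate the components A_X and assemble into a retraction, the
poset being finite. -/
theorem exists_leftInverse_osSumMap (I : Set 𝒜.IntersectionPoset) :
    ∃ r : 𝒜.OSAlgebra K →ₗ[K] OSSum K I, r ∘ₗ osSumMap K I = LinearMap.id := by
  classical
  unfold osSumMap
  convert exists_leftInverse_coeLinearMap (fun X : I => osComponent K X.1)
    (fun X => interProj K X.1.1) (fun X x => interProj_mem K X.1 x) ?_ ?_
  · intro X x hx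
    rw [osComponent_eq_span] at hx
    refine LinearMap.eqOn_span (f := interProj K X.1.1) (g := LinearMap.id) ?_ hx
    rintro _ ⟨S, hS, rfl⟩
    rw [interProj_osE, if_pos hS, LinearMap.id_apply]
  · intro X Y hXY x hx
    rw [osComponent_eq_span] at hx
    refine LinearMap.eqOn_span (f := interProj K Y.1.1) (g := 0) ?_ hx
    rintro _ ⟨S, hS, rfl⟩
    rw [interProj_osE, if_neg, LinearMap.zero_apply]
    exact fun h => hXY (Subtype.ext (Subtype.ext (hS.symm.trans h)))

variable {I J : Set 𝒜.IntersectionPoset}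

theorem kappa_injective
    (hD : IsIdealDecomposition ![I, J]) : Function.Injective (kappa K I J) := by
  have hmem : ∀ d, TensorProduct.map (osSumMap K I) (osSumMap K J) d ∈
      ⨆ X, tensorComponent K I J X := by
    intro d
    refine Submodule.span_le.2 ?_
      (TensorProduct.map_mem_span (osSumMap_mem_span K I) (osSumMap_mem_span K J) d)
    rintro _ ⟨_, ⟨S, hS, rfl⟩, _, ⟨T, hT, rfl⟩, rfl⟩
    exact Submodule.mem_iSup_of_mem _ (tmul_mem_tensorComponent K hS hT)
  rw [kappa_eq]
  exact injective_mul'_comp_map (exists_leftInverse_osSumMap K I) (exists_leftInverse_osSumMap K J)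
    (tensorComponent K I J) (interProj K) hmem
    (fun X t ht => interProj_mul_of_mem K ht)
    (fun X Y h t ht => interProj_mul_of_mem_of_ne K h ht)
    (fun X t ht h => eq_zero_of_mem_tensorComponent K hD X ht h)

theorem map_kappa_osTensorDegree
    (hD : IsIdealDecomposition ![I, J]) (p : ℕ) :
    (osTensorDegree K I J p).map (kappa K I J) = osDegree 𝒜 K p := by
  apply le_antisymm
  · rw [Submodule.map_le_iff_le_comap]
    refine iSup_le fun i => iSup_le fun j => iSup_le fun hij => ?_
    exact hij ▸ range_map_subtype_le_comap_kappa K I J i j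
  · rw [osDegree_eq_span, Submodule.span_le]
    rintro _ ⟨S, hS, rfl⟩
    -- Monomials with empty intersection vanish in A. For the others, `productSet` records total
    -- length, so the preimage has the right degree.
    by_cases hne : (inter S : Set V).Nonempty
    · refine Submodule.span_le.2 ?_ (osE_mem_span_productSet K hD S hne)
      rintro _ ⟨S', T', hS', hT', -, -, hl, rfl⟩
      obtain ⟨x, hx, hxS⟩ := exists_osSumMap_eq K hS'
      obtain ⟨y, hy, hyT⟩ := exists_osSumMap_eq K hT'
      exact ⟨x ⊗ₜ y, tmul_mem_osTensorDegree K hx hy (hl.trans hS),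
        (kappa_tmul K I J x y).trans (congrArg₂ _ hxS hyT)⟩
    · have h0 : osE K S = 0 := osProj_of_inter_empty K hne
      rw [h0]
      exact zero_mem _

theorem kappa_bijective
    (hD : IsIdealDecomposition ![I, J]) : Function.Bijective (kappa K I J) := by
  refine ⟨kappa_injective K hD, ?_⟩
  rw [← LinearMap.range_eq_top, eq_top_iff, ← (isInternal_osDegree 𝒜 K).submodule_iSup_eq_top]
  refine iSup_le fun p => ?_
  rw [← map_kappa_osTensorDegree K hD p]
  exact LinearMap.map_le_range

end Main

end HyperplaneArrangement

theorem mainTheorem2 {F V K : Type*} [Field F] [AddCommGroup V] [Module F V]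
    [FiniteDimensional F V] [CommRing K] (𝒜 : HyperplaneArrangement F V)
    (I : Set 𝒜.IntersectionPoset) (hI : HyperplaneArrangement.IsModularIdeal I) :
    -- both sides are graded modules
    DirectSum.IsInternal (HyperplaneArrangement.osTensorDegree K I
      (HyperplaneArrangement.meetComplement I)) ∧
    DirectSum.IsInternal (HyperplaneArrangement.osDegree 𝒜 K) ∧
    -- multiplication respects the gradings and is an isomorphism
    (∀ p : ℕ, (HyperplaneArrangement.osTensorDegree K I
        (HyperplaneArrangement.meetComplement I) p).map
        (HyperplaneArrangement.kappa K I (HyperplaneArrangement.meetComplement I)) =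
      HyperplaneArrangement.osDegree 𝒜 K p) ∧
    Function.Bijective
      (HyperplaneArrangement.kappa K I (HyperplaneArrangement.meetComplement I)) := by
  have hbij := HyperplaneArrangement.kappa_bijective K hI
  have hmap := HyperplaneArrangement.map_kappa_osTensorDegree K hI
  have hint := HyperplaneArrangement.isInternal_osDegree 𝒜 K
  -- The decomposition of the tensor product is pulled back from that of A along the bijection κ.
  exact ⟨.of_map_eq hbij hmap hint, hint, hmap, hbij⟩
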